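/- Fix an integer $d \ge 2$ and a probability distribution on $[0,\infty)$ with a density, with cumulative distribution function $F(x)=\mathbb{P}[W\le x]$ and quantile function $F^{-1}(p)=\inf\{x\ge 0 : p\le F(x)\}$. Let $c>0$ and $\theta_n = cn/\log n$. The geographical threshold graph (GTG) $G=G_n$ on the $d$-dimensional toric unit cube has $n$ nodes placed independently and uniformly at random on $[0,1]^d$ with opposite faces identified; each node $i$ receives an independent random weight $w_i$ with the above distribution, independent of the positions, and distinct nodes $i,j$ are adjacent if and only if $(w_i+w_j)/r_{ij}^d \ge \theta_n$, where $r_{ij}$ is the Euclidean distance on the torus. For a graph $G$ with edge set $E$, let $P$ be the transition matrix of the simple random walk on $G$, let $\pi_j=\deg(j)/(2|E|)$, and let $\Delta_i(t)=\frac12\sum_j |P^t(i,j)-\pi_j|$. The mixing time is $\tau(\delta)=\max_i \min\{t : \Delta_i(t')\le\delta \text{ for all } t'\ge t\}$ (infinite if no such $t$ exists for some $i$). Suppose that for some $\nu>0$ we have $\mathbb{P}[W\ge x]=O(1/x^{d+\nu})$ as $x\to\infty$, and that $$c \le \frac{1}{d+3}\min\Big\{\sup_{\alpha\in(0,1/2]}\alpha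 F^{-1}(\alpha),\ \sup_{\alpha\in(1/2,1)}(1-\alpha)F^{-1}(\alpha)\Big\}.$$ Then with probability $1-o(1)$ as $n\to\infty$, if $G$ is connected then $\tau(1/n)=O\big(n^{2/d}(\log n)^{(d-2)/d}\big)$. That is, there is a constant $K$, independent of $n$ (it may depend on $d$, $c$ and the weight distribution), such that $$\mathbb{P}\big[G_n \text{ is connected and } \tau(1/n) > K n^{2/d}(\log n)^{(d-2)/d}\big]\to 0 .$$ -/

import Mathlib

open MeasureTheory ProbabilityTheory Filter Topology
open scoped ENNReal

/-! ### Simple random walk on a finite graph and its mixing time -/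

namespace SimpleGraph

open Classical in
/-- One-step transition matrix of the simple random walk on a finite graph. -/
noncomputable def walkMatrix {V : Type*} [Fintype V] (G : SimpleGraph V) : Matrix V V ℝ :=
  fun i j => if G.Adj i j then 1 / (G.degree i : ℝ) else 0

open Classical in
/-- The distribution `π k = deg k / (2 |E|)`. -/
noncomputable def walkStationary {V : Type*} [Fintype V] (G : SimpleGraph V) (k : V) : ℝ :=
  (G.degree k : ℝ) / (2 * (G.edgeFinset.card : ℝ))

/-- Variational distance `Δ_i(t) = (1/2) ∑ j, |P^t(i,j) - π j|`. -/
noncomputable def walkDist {V : Type*} [Fintype V] [DecidableEq V] (G : SimpleGraph V)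
    (i : V) (t : ℕ) : ℝ :=
  (1 / 2) * ∑ j, |(G.walkMatrix ^ t) i j - G.walkStationary j|

/-- Mixing time from `i`: the least `t` with `Δ_i(t') ≤ δ` for all `t' ≥ t`
(`⊤` if there is no such `t`). -/
noncomputable def mixingTimeFrom {V : Type*} [Fintype V] [DecidableEq V] (G : SimpleGraph V) (δ : ℝ)
    (i : V) : ℕ∞ :=
  ⨅ t ∈ {t : ℕ | ∀ t' ≥ t, G.walkDist i t' ≤ δ}, (t : ℕ∞)

/-- Mixing time of `G`: the maximum over the starting vertices. -/
noncomputable def mixingTime {V : Type*} [Fintype V] [DecidableEq V] (G : SimpleGraph V)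
    (δ : ℝ) : ℕ∞ :=
  ⨆ i, G.mixingTimeFrom δ i

end SimpleGraph

/-! ### Geographical threshold graphs -/

namespace GTG

/-- Euclidean distance on the `d`-dimensional toric unit cube `(ℝ/ℤ)^d`; the norm on `ℝ/ℤ` is the
distance to the nearest integer. -/
noncomputable def toricDist {d : ℕ} (x y : UnitAddTorus (Fin d)) : ℝ :=
  Real.sqrt (∑ i, ‖x i - y i‖ ^ 2)

/-- A configuration of `n` nodes: each node has a position on the torus and a weight. -/
abbrev Config (d n : ℕ) : Type := Fin n → UnitAddTorus (Fin d) × ℝ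

/-- The geographical threshold graph of a configuration with threshold `θ`: distinct nodes `i, j`
are adjacent when `(w_i + w_j) / r_ij ^ d ≥ θ`, written without division so that nodes at distance
zero cause no trouble. -/
noncomputable def graph {d n : ℕ} (θ : ℝ) (ω : Config d n) : SimpleGraph (Fin n) where
  Adj i j := i ≠ j ∧ θ * toricDist (ω i).1 (ω j).1 ^ d ≤ (ω i).2 + (ω j).2
  symm := ⟨fun i j h => ⟨h.1.symm, by
    have hd : toricDist (ω j).1 (ω i).1 = toricDist (ω i).1 (ω j).1 := by
      unfold toricDist
      simp only [norm_sub_rev]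
    rw [hd, add_comm]
    exact h.2⟩⟩
  loopless := ⟨fun _ h => h.1 rfl⟩

/-- The law of the model: `n` independent nodes, each with a uniform position on the torus and an
independent weight of law `ρ`. -/
noncomputable def law (d : ℕ) (ρ : Measure ℝ) (n : ℕ) : Measure (Config d n) :=
  Measure.pi fun _ => (volume : Measure (UnitAddTorus (Fin d))).prod ρ

/-- Quantile function `F⁻¹(p) = inf {x ≥ 0 : p ≤ F(x)}` of the weight law. -/
noncomputable def quantile (ρ : Measure ℝ) (p : ℝ) : ℝ :=
  sInf {x : ℝ | 0 ≤ x ∧ p ≤ cdf ρ x}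

/-- A sequence of events holds with high probability: the probability of failure is `o(1)`. -/
def Whp {d : ℕ} (ρ : Measure ℝ) (A : (n : ℕ) → Set (Config d n)) : Prop :=
  Tendsto (fun n => law d ρ n (A n)ᶜ) atTop (𝓝 0)

end GTG

/-
Divide the torus into cells of volume about `log n / n`, giving `M ^ d` lattice points with `M` of
order `(n / log n) ^ (1 / d)`. Since the weights charge some half-line `[m₀, ∞)`, `m₀ > 0`, most
cells contain a cluster of order `log n` nodes of weight at least `m₀`, and nodes of neighbouring
clusters are adjacent. By a union bound at most a constant number of cells in any bounded
neighbourhood lack such a cluster, so the populated cells contain a local backbone around which the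
remaining nodes are trapped in regions of bounded size: an edge long enough to escape would have a
heavy endpoint, itself adjacent to the backbone. Finite mean of the weights bounds by `O(log n)` the
number of nodes in a bounded neighbourhood and the number of heavier neighbours of a node; the
degrees themselves are not so bounded, and edges are charged to their lighter endpoint.

Comparing `f` with its cluster averages, the Poincaré inequality on the discrete torus, with
constant `O(M ^ 2)`, yields one for the connected graph: the factor `(log n) ^ 2` lost in passing
from nodes to clusters is regained because neighbouring clusters are joined by order `(log n) ^ 2`
edges. The graph contains cliques everywhere, so the signless Laplacian satisfies the same kind of
bound and the spectrum of the walk stays away from `-1` as well. Hence the relaxation time is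
`O(M ^ 2)` and the mixing time is `O(M ^ 2 log n) = O(n ^ (2 / d) (log n) ^ ((d - 2) / d))`.
-/

open scoped Matrix

/-! ### Reversible chains -/

/-- Polarisation at `f ± l⁻¹ • g`, the scale at which the two sides become comparable. -/
theorem bilinForm_apply_self_le_of_abs_le {E : Type*} [AddCommGroup E] [Module ℝ E]
    (N B : LinearMap.BilinForm ℝ E) (hB : B.IsSymm) {f g : E} {l : ℝ} (hl : 0 < l)
    (hg : B f g = N g g)
    (hform : ∀ t : ℝ, |B (f + t • g) (f + t • g)| ≤ l * N (f + t • g) (f + t • g)) :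
    N g g ≤ l ^ 2 * N f f := by
  have hplus := (abs_le.1 (hform l⁻¹)).2
  have hminus := (abs_le.1 (hform (-l⁻¹))).1
  have hg' : B g f = N g g := by rw [← hg]; exact (hB.eq f g).symm
  simp only [map_add, map_smul, LinearMap.add_apply, LinearMap.smul_apply, smul_eq_mul, hg, hg']
    at hplus hminus
  have hpolar : 4 * l⁻¹ * N g g ≤ 2 * l * N f f + 2 * (l * l⁻¹) * l⁻¹ * N g g := by linarith
  rw [mul_inv_cancel₀ hl.ne'] at hpolar
  have hle : l⁻¹ * N g g ≤ l * N f f := by linarith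
  rw [inv_mul_le_iff₀ hl] at hle
  linarith

namespace ReversibleChain

variable {V : Type*} [Fintype V] (W : Matrix V V ℝ)

/-- The total conductance at a vertex of the network whose edge conductances are the entries
of `W`; it is an unnormalised stationary weight of the walk. -/
def conductance (x : V) : ℝ := ∑ y, W x y

/-- The transition matrix of the random walk on the network with conductances `W`. -/
noncomputable def transition : Matrix V V ℝ := .of fun x y => W x y / conductance W x

variable {W}

theorem conductance_mul_transition_mulVec (hD : ∀ x, conductance W x ≠ 0) (f : V → ℝ) (x : V) :
    conductance W x * (transition W *ᵥ f) x = (W *ᵥ f) x := by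
  simp only [Matrix.mulVec, dotProduct, transition, Matrix.of_apply, Finset.mul_sum]
  refine Finset.sum_congr rfl fun y _ => ?_
  rw [← mul_assoc, mul_div_cancel₀ _ (hD x)]

theorem transition_mulVec_one (hD : ∀ x, conductance W x ≠ 0) : transition W *ᵥ 1 = 1 := by
  ext x
  refine mul_left_cancel₀ (hD x) ?_
  rw [conductance_mul_transition_mulVec hD]
  simp [Matrix.mulVec, dotProduct, conductance]

variable [DecidableEq V]

theorem transition_pow_mulVec_one (hD : ∀ x, conductance W x ≠ 0) (t : ℕ) :
    (transition W ^ t) *ᵥ 1 = 1 := by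
  induction t with
  | zero => simp
  | succ t ih => rw [pow_succ, ← Matrix.mulVec_mulVec, transition_mulVec_one hD, ih]

/-- Detailed balance. -/
theorem conductance_mul_transition_pow_comm (hW : W.IsSymm) (hD : ∀ x, conductance W x ≠ 0)
    (t : ℕ) (x y : V) :
    conductance W x * (transition W ^ t) x y = conductance W y * (transition W ^ t) y x := by
  have hcomm : Matrix.diagonal (conductance W) * transition W
      = (transition W)ᵀ * Matrix.diagonal (conductance W) := by
    ext a b
    rw [Matrix.diagonal_mul, Matrix.mul_diagonal, Matrix.transpose_apply, transition,
      Matrix.of_apply, Matrix.of_apply, mul_div_cancel₀ _ (hD a), div_mul_cancel₀ _ (hD b),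
      hW.apply]
  have hpow : Matrix.diagonal (conductance W) * transition W ^ t
      = (transition W ^ t)ᵀ * Matrix.diagonal (conductance W) := by
    rw [Matrix.transpose_pow]
    exact SemiconjBy.pow_right hcomm t
  have hentry := congrFun (congrFun hpow x) y
  rwa [Matrix.diagonal_mul, Matrix.mul_diagonal, Matrix.transpose_apply,
    mul_comm _ (conductance W y)] at hentry

variable (W) in
/-- The density at time `t` of the walk started from `i`, relative to the conductance measure, minus
the density `1 / ∑ y, conductance W y` of the stationary distribution. -/
noncomputable def deviation (i : V) (t : ℕ) (x : V) : ℝ :=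
  (transition W ^ t) x i / conductance W i - 1 / ∑ y, conductance W y

theorem transition_mulVec_deviation (hD : ∀ x, conductance W x ≠ 0) (i : V) (t : ℕ) :
    transition W *ᵥ deviation W i t = deviation W i (t + 1) := by
  have hsplit : ∀ s, deviation W i s
      = (conductance W i)⁻¹ • ((transition W ^ s) *ᵥ Pi.single i 1)
        - (1 / ∑ y, conductance W y) • 1 := by
    intro s
    ext x
    simp [deviation, div_eq_inv_mul]
  rw [hsplit, hsplit, Matrix.mulVec_sub, Matrix.mulVec_smul, Matrix.mulVec_smul,
    Matrix.mulVec_mulVec, ← pow_succ', transition_mulVec_one hD]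

theorem conductance_mul_deviation (hW : W.IsSymm) (hD : ∀ x, conductance W x ≠ 0) (i j : V)
    (t : ℕ) : conductance W j * deviation W i t j
      = (transition W ^ t) i j - conductance W j / ∑ y, conductance W y := by
  rw [deviation, mul_sub, ← mul_div_assoc, ← conductance_mul_transition_pow_comm hW hD,
    mul_div_cancel_left₀ _ (hD i), mul_one_div]

variable (hW : W.IsSymm) (hD : ∀ x, 0 < conductance W x)
include hW hD

theorem sum_conductance_mul_deviation (i : V) (t : ℕ) :
    ∑ x, conductance W x * deviation W i t x = 0 := by
  have hD' := fun x => (hD x).ne'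
  have hS : ∑ y, conductance W y ≠ 0 :=
    (Finset.sum_pos (fun x _ => hD x) ⟨i, Finset.mem_univ i⟩).ne'
  have hrow : ∑ j, (transition W ^ t) i j = 1 := by
    have := congrFun (transition_pow_mulVec_one hD' t) i
    simpa [Matrix.mulVec, dotProduct] using this
  simp_rw [conductance_mul_deviation hW hD', Finset.sum_sub_distrib, ← Finset.sum_div]
  rw [hrow, div_self hS, sub_self]

theorem sum_conductance_mul_sq_deviation_zero_le (i : V) :
    ∑ x, conductance W x * deviation W i 0 x ^ 2 ≤ 1 / conductance W i := by
  have hS : 0 ≤ ∑ y, conductance W y := Finset.sum_nonneg fun x _ => (hD x).le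
  have hsq : ∑ x, conductance W x * deviation W i 0 x ^ 2 = deviation W i 0 i := by
    calc ∑ x, conductance W x * deviation W i 0 x ^ 2
        = ∑ x, ((Pi.single i 1 : V → ℝ) x * deviation W i 0 x
            - (conductance W x * deviation W i 0 x) / ∑ y, conductance W y) := by
          refine Finset.sum_congr rfl fun x _ => ?_
          have hx := conductance_mul_deviation hW (fun x => (hD x).ne') i x 0
          rw [pow_zero, Matrix.one_eq_pi_single] at hx
          rw [sq, ← mul_assoc]
          nth_rewrite 1 [hx]
          ring
      _ = deviation W i 0 i := by
          rw [Finset.sum_sub_distrib, ← Finset.sum_div, sum_conductance_mul_deviation hW hD]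
          simp [Pi.single_apply]
  rw [hsq, deviation, pow_zero, Matrix.one_apply_eq]
  exact sub_le_self _ (one_div_nonneg.2 hS)

variable {l : ℝ} (hl : 0 < l)
  (hform : ∀ f : V → ℝ, ∑ x, conductance W x * f x = 0 →
    |f ⬝ᵥ W *ᵥ f| ≤ l * ∑ x, conductance W x * f x ^ 2)
include hl hform

theorem sum_conductance_mul_sq_deviation_succ_le (i : V) (t : ℕ) :
    ∑ x, conductance W x * deviation W i (t + 1) x ^ 2
      ≤ l ^ 2 * ∑ x, conductance W x * deviation W i t x ^ 2 := by
  have hN : ∀ f : V → ℝ, Matrix.toBilin' (Matrix.diagonal (conductance W)) f f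
      = ∑ x, conductance W x * f x ^ 2 := by
    intro f
    rw [Matrix.toBilin'_apply']
    simp only [dotProduct, Matrix.mulVec_diagonal]
    exact Finset.sum_congr rfl fun x _ => by ring
  have hB : ∀ f g : V → ℝ, f ⬝ᵥ W *ᵥ g = g ⬝ᵥ W *ᵥ f := by
    intro f g
    rw [Matrix.dotProduct_mulVec, dotProduct_comm, ← Matrix.mulVec_transpose, hW]
  simp only [← hN]
  refine bilinForm_apply_self_le_of_abs_le _ (Matrix.toBilin' W) ⟨fun f g => ?_⟩ hl ?_
    fun s => ?_
  · simpa only [Matrix.toBilin'_apply'] using hB f g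
  · have hD' := fun x => (hD x).ne'
    rw [hN, Matrix.toBilin'_apply', hB, dotProduct]
    refine Finset.sum_congr rfl fun x _ => ?_
    rw [← conductance_mul_transition_mulVec hD', transition_mulVec_deviation hD']
    ring
  · rw [hN, Matrix.toBilin'_apply']
    refine hform _ ?_
    simp only [Pi.add_apply, Pi.smul_apply, smul_eq_mul, mul_add, mul_left_comm _ s,
      Finset.sum_add_distrib, ← Finset.mul_sum, sum_conductance_mul_deviation hW hD]
    ring

theorem sum_conductance_mul_sq_deviation_le (i : V) (t : ℕ) :
    ∑ x, conductance W x * deviation W i t x ^ 2 ≤ (l ^ t) ^ 2 / conductance W i := by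
  induction t with
  | zero => simpa using sum_conductance_mul_sq_deviation_zero_le hW hD i
  | succ t ih =>
    calc _ ≤ l ^ 2 * ∑ x, conductance W x * deviation W i t x ^ 2 :=
          sum_conductance_mul_sq_deviation_succ_le hW hD hl hform i t
      _ ≤ l ^ 2 * ((l ^ t) ^ 2 / conductance W i) := by gcongr
      _ = (l ^ (t + 1)) ^ 2 / conductance W i := by ring

theorem sum_abs_transition_pow_sub_le (i : V) (t : ℕ) :
    ∑ j, |(transition W ^ t) i j - conductance W j / ∑ x, conductance W x|
      ≤ √((∑ x, conductance W x) / conductance W i) * l ^ t := by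
  set S := ∑ x, conductance W x with hS
  have hS0 : 0 ≤ S := Finset.sum_nonneg fun x _ => (hD x).le
  have hterm : ∀ j, |(transition W ^ t) i j - conductance W j / S|
      = √(conductance W j) * (√(conductance W j) * |deviation W i t j|) := by
    intro j
    rw [← conductance_mul_deviation hW (fun x => (hD x).ne'), abs_mul, abs_of_pos (hD j),
      ← mul_assoc, Real.mul_self_sqrt (hD j).le]
  refine abs_le_of_sq_le_sq' ?_ (by positivity) |>.2
  calc _ ≤ S * ∑ j, conductance W j * deviation W i t j ^ 2 := by
        simp_rw [hterm]
        refine (Finset.sum_mul_sq_le_sq_mul_sq _ _ _).trans_eq ?_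
        simp only [mul_pow, Real.sq_sqrt (hD _).le, sq_abs, hS]
    _ ≤ S * ((l ^ t) ^ 2 / conductance W i) := by
        gcongr
        exact sum_conductance_mul_sq_deviation_le hW hD hl hform i t
    _ = _ := by
        rw [mul_pow, Real.sq_sqrt (div_nonneg hS0 (hD i).le)]
        ring

end ReversibleChain

/-! ### A Poincaré inequality on the discrete torus -/

section Shift

variable {A : Type*} [Fintype A] [AddCommGroup A]

/-- The `ℓ²` norm of the increment of `g` along `v`; it is subadditive in `v`. -/
noncomputable def shiftNorm (g : A → ℝ) (v : A) : ℝ :=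
  ‖WithLp.toLp 2 fun a => g (a + v) - g a‖

variable (g : A → ℝ)

theorem shiftNorm_sq (v : A) : shiftNorm g v ^ 2 = ∑ a, (g (a + v) - g a) ^ 2 := by
  simp [shiftNorm, EuclideanSpace.norm_sq_eq]

theorem shiftNorm_nonneg (v : A) : 0 ≤ shiftNorm g v := norm_nonneg _

theorem shiftNorm_zero : shiftNorm g 0 = 0 := by
  have hsq : shiftNorm g 0 ^ 2 = 0 := by simp [shiftNorm_sq]
  exact pow_eq_zero_iff two_ne_zero |>.1 hsq

theorem shiftNorm_add_le (v w : A) : shiftNorm g (v + w) ≤ shiftNorm g v + shiftNorm g w := by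
  have htranslate : shiftNorm g v = ‖WithLp.toLp 2 fun a => g (a + w + v) - g (a + w)‖ := by
    refine (pow_left_inj₀ (shiftNorm_nonneg g v) (norm_nonneg _) two_ne_zero).1 ?_
    rw [shiftNorm_sq, EuclideanSpace.norm_sq_eq]
    simp only [Real.norm_eq_abs, sq_abs]
    exact (Equiv.sum_comp (Equiv.addRight w) fun a => (g (a + v) - g a) ^ 2).symm
  rw [htranslate]
  refine le_trans (le_of_eq ?_) (norm_add_le _ _)
  rw [shiftNorm, ← WithLp.toLp_add]
  congr 2
  ext a
  simp [add_comm v w, add_assoc]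

theorem shiftNorm_nsmul_le (k : ℕ) (v : A) : shiftNorm g (k • v) ≤ k * shiftNorm g v := by
  induction k with
  | zero => simp [shiftNorm_zero]
  | succ k ih =>
    rw [succ_nsmul, Nat.cast_succ, add_one_mul]
    exact (shiftNorm_add_le g _ _).trans (by gcongr)

theorem sum_sum_sq_sub_eq_sum_shiftNorm_sq :
    ∑ a, ∑ b, (g b - g a) ^ 2 = ∑ v, shiftNorm g v ^ 2 := by
  simp_rw [shiftNorm_sq]
  rw [Finset.sum_comm (s := Finset.univ) (t := Finset.univ)
    (f := fun v a => (g (a + v) - g a) ^ 2)]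
  exact Finset.sum_congr rfl fun a _ =>
    (Equiv.sum_comp (Equiv.addLeft a) fun b => (g b - g a) ^ 2).symm

theorem sum_sum_sq_sub_le_of_generators {ι : Type*} [Fintype ι] (e : ι → A) (m : ℕ)
    (he : ∀ v : A, ∃ k : ι → ℕ, (∀ i, k i ≤ m) ∧ v = ∑ i, k i • e i) :
    ∑ a, ∑ b, (g b - g a) ^ 2
      ≤ Fintype.card ι * m ^ 2 * Fintype.card A * ∑ a, ∑ i, (g (a + e i) - g a) ^ 2 := by
  have hle : ∀ v, shiftNorm g v ^ 2 ≤ Fintype.card ι * m ^ 2 * ∑ i, shiftNorm g (e i) ^ 2 := by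
    intro v
    obtain ⟨k, hk, rfl⟩ := he v
    have hsum : shiftNorm g (∑ i, k i • e i) ≤ ∑ i, m * shiftNorm g (e i) := by
      refine (Finset.le_sum_of_subadditive (shiftNorm g) (shiftNorm_zero g).le
        (shiftNorm_add_le g) _ _).trans (Finset.sum_le_sum fun i _ => ?_)
      refine (shiftNorm_nsmul_le g _ _).trans ?_
      exact mul_le_mul_of_nonneg_right (by exact_mod_cast hk i) (shiftNorm_nonneg g _)
    calc shiftNorm g (∑ i, k i • e i) ^ 2 ≤ (∑ i, m * shiftNorm g (e i)) ^ 2 :=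
          pow_le_pow_left₀ (shiftNorm_nonneg g _) hsum 2
      _ ≤ Fintype.card ι * ∑ i, (m * shiftNorm g (e i)) ^ 2 := sq_sum_le_card_mul_sum_sq
      _ = Fintype.card ι * m ^ 2 * ∑ i, shiftNorm g (e i) ^ 2 := by
          simp only [mul_pow, ← Finset.mul_sum, mul_assoc]
  calc ∑ a, ∑ b, (g b - g a) ^ 2 = ∑ v, shiftNorm g v ^ 2 :=
        sum_sum_sq_sub_eq_sum_shiftNorm_sq g
    _ ≤ ∑ _v : A, Fintype.card ι * m ^ 2 * ∑ i, shiftNorm g (e i) ^ 2 :=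
        Finset.sum_le_sum fun v _ => hle v
    _ = _ := by
        rw [Finset.sum_const, Finset.card_univ, nsmul_eq_mul, Finset.sum_comm]
        simp_rw [shiftNorm_sq]
        ring

end Shift

theorem sum_sum_sq_sub_le_of_torus {d M : ℕ} [NeZero M] (g : (Fin d → ZMod M) → ℝ) :
    ∑ a, ∑ b, (g b - g a) ^ 2 ≤
      (d : ℝ) * M ^ 2 * M ^ d * ∑ a, ∑ j, (g (a + Pi.single j 1) - g a) ^ 2 := by
  refine (sum_sum_sq_sub_le_of_generators g (fun j => Pi.single j 1) M fun v =>
    ⟨fun j => (v j).val, fun j => (ZMod.val_lt (v j)).le, ?_⟩).trans_eq ?_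
  · ext k
    rw [Finset.sum_apply]
    simp [Pi.single_apply]
  · simp

/-! ### Sparsely perforated lattice boxes -/

/-- The subgraph of `G` formed by the edges inside `S`, on the same vertex type. -/
def within {V : Type*} (G : SimpleGraph V) (S : Set V) : SimpleGraph V :=
  (G.induce S).spanningCoe

section Within

variable {V : Type*} {G : SimpleGraph V} {S T : Set V} {x y : V}

theorem within_adj : (within G S).Adj x y ↔ x ∈ S ∧ y ∈ S ∧ G.Adj x y := by
  simp [within]
  tauto

theorem within_mono (h : S ⊆ T) : within G S ≤ within G T := fun _ _ hxy =>
  have ⟨hx, hy, hadj⟩ := within_adj.1 hxy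
  within_adj.2 ⟨h hx, h hy, hadj⟩

theorem mem_of_reachable_within (hx : x ∈ S) (h : (within G S).Reachable x y) : y ∈ S := by
  obtain ⟨p⟩ := h
  induction p with
  | nil => exact hx
  | cons hadj _ ih => exact ih (within_adj.1 hadj).2.1

end Within

section Lattice

variable {α : Type*} [Lattice α] [LocallyFiniteOrder α] {P : Set α} {x y : α}

theorem reachable_of_Icc_subset (hxy : x ≤ y) (h : Set.Icc x y ⊆ P) :
    (within (SimpleGraph.hasse α) P).Reachable x y := by
  induction le_iff_reflTransGen_covBy.1 hxy with
  | refl => rfl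
  | tail hxb hbc ih =>
    have hxb := le_iff_reflTransGen_covBy.2 hxb
    have hadj := within_adj.2
      ⟨h ⟨hxb, hbc.le⟩, h ⟨hxy, le_rfl⟩, SimpleGraph.hasse_adj.2 (Or.inl hbc)⟩
    exact (ih hxb ((Set.Icc_subset_Icc_right hbc.le).trans h)).trans hadj.reachable

theorem reachable_of_uIcc_subset (h : Set.uIcc x y ⊆ P) :
    (within (SimpleGraph.hasse α) P).Reachable x y :=
  (reachable_of_Icc_subset le_sup_left ((Set.Icc_subset_Icc_left inf_le_left).trans h)).trans
    (reachable_of_Icc_subset le_sup_right ((Set.Icc_subset_Icc_left inf_le_right).trans h)).symm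

end Lattice

namespace Grid

/-- The cube `[-r, r]^d` of the lattice `ℤ^d`. -/
noncomputable def box (d r : ℕ) : Finset (Fin d → ℤ) := Finset.Icc (-(r : Fin d → ℤ)) r

variable {d : ℕ} {P : Set (Fin d → ℤ)}

theorem mem_box {r : ℕ} {v : Fin d → ℤ} : v ∈ box d r ↔ ∀ k, -(r : ℤ) ≤ v k ∧ v k ≤ r := by
  simp [box, Pi.le_def, forall_and]

theorem box_mono {r r' : ℕ} (h : r ≤ r') : box d r ⊆ box d r' := fun v hv =>
  mem_box.2 fun k => by have := mem_box.1 hv k; omega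

theorem update_mem_box {r : ℕ} {v : Fin d → ℤ} (hv : v ∈ box d r) (i : Fin d) {b : ℤ}
    (hb : -(r : ℤ) ≤ b ∧ b ≤ r) : Function.update v i b ∈ box d r :=
  mem_box.2 fun k => by
    rcases eq_or_ne k i with rfl | hk
    · rwa [Function.update_self]
    · rw [Function.update_of_ne hk]
      exact mem_box.1 hv k

theorem add_mem_box {r s : ℕ} {v w : Fin d → ℤ} (hv : v ∈ box d r) (hw : w ∈ box d s) :
    v + w ∈ box d (r + s) :=
  mem_box.2 fun k => by
    have := mem_box.1 hv k
    have := mem_box.1 hw k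
    rw [Pi.add_apply]
    omega

theorem single_mem_box (i : Fin d) (r : ℕ) : (Pi.single i (r : ℤ) : Fin d → ℤ) ∈ box d r :=
  mem_box.2 fun k => by rw [Pi.single_apply]; split_ifs <;> omega

theorem coe_box (r : ℕ) : (box d r : Set (Fin d → ℤ)) = Set.Icc (-(r : Fin d → ℤ)) r :=
  Finset.coe_Icc _ _

theorem mem_Icc_add {r : ℕ} {v w : Fin d → ℤ} :
    v ∈ Set.Icc (-(r : Fin d → ℤ) + w) ((r : Fin d → ℤ) + w) ↔ v - w ∈ box d r := by
  rw [← Finset.mem_coe, coe_box, Set.mem_Icc, Set.mem_Icc, le_sub_iff_add_le, sub_le_iff_le_add]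

theorem reachable_of_slab_subset {l u : Fin d → ℤ} {i : Fin d} {b : ℤ}
    (hslab : ∀ v ∈ Set.Icc l u, v i = b → v ∈ P) {x y : Fin d → ℤ} (hx : x ∈ Set.Icc l u)
    (hy : y ∈ Set.Icc l u) (hxi : x i = b) (hyi : y i = b) :
    (within (SimpleGraph.hasse (Fin d → ℤ)) (P ∩ Set.Icc l u)).Reachable x y := by
  refine reachable_of_uIcc_subset fun v hv => ?_
  have hvQ := Set.uIcc_subset_Icc hx hy hv
  have hvi : v i ∈ Set.uIcc (x i) (y i) := ⟨hv.1 i, hv.2 i⟩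
  rw [hxi, hyi, Set.uIcc_self] at hvi
  exact ⟨hslab v hvQ hvi, hvQ⟩

open Classical in
theorem exists_slab_subset {Q : Finset (Fin d → ℤ)} {k : ℕ}
    (hP : (Q.filter (· ∉ P)).card ≤ k) (i : Fin d) :
    ∃ b : ℤ, (0 ≤ b ∧ b ≤ k) ∧ ∀ v ∈ Q, v i = b → v ∈ P := by
  have hlt : ((Q.filter (· ∉ P)).image (· i)).card < (Finset.Icc (0 : ℤ) k).card := by
    have := (Finset.card_image_le (s := Q.filter (· ∉ P)) (f := (· i))).trans hP
    simp only [Int.card_Icc]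
    omega
  obtain ⟨b, hb, hb'⟩ := Finset.exists_mem_notMem_of_card_lt_card hlt
  refine ⟨b, Finset.mem_Icc.1 hb, fun v hv hvb => ?_⟩
  by_contra hvP
  exact hb' (Finset.mem_image.2 ⟨v, Finset.mem_filter.2 ⟨hv, hvP⟩, hvb⟩)

/-- From `t` one moves inside the slab of the box `[l₁, u₁]` orthogonal to `j`, then inside the slab
of `[l, u]` orthogonal to `i`, and finally inside the slab of `[l₂, u₂]` orthogonal to `j`. -/
theorem reachable_of_slabs {l u l₁ u₁ l₂ u₂ : Fin d → ℤ} (h₁ : Set.Icc l₁ u₁ ⊆ Set.Icc l u)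
    (h₂ : Set.Icc l₂ u₂ ⊆ Set.Icc l u) {i j : Fin d} (hij : i ≠ j) {b : ℤ} {t t' : Fin d → ℤ}
    (hslab : ∀ v ∈ Set.Icc l u, v i = b → v ∈ P)
    (hslab₁ : ∀ v ∈ Set.Icc l₁ u₁, v j = t j → v ∈ P)
    (hslab₂ : ∀ v ∈ Set.Icc l₂ u₂, v j = t' j → v ∈ P)
    (ht : t ∈ Set.Icc l₁ u₁) (ht' : t' ∈ Set.Icc l₂ u₂)
    (htb : Function.update t i b ∈ Set.Icc l₁ u₁)
    (htb' : Function.update t' i b ∈ Set.Icc l₂ u₂) :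
    (within (SimpleGraph.hasse (Fin d → ℤ)) (P ∩ Set.Icc l u)).Reachable t t' := by
  have hj : ∀ s : Fin d → ℤ, Function.update s i b j = s j := fun s =>
    Function.update_of_ne hij.symm _ _
  have hstart := reachable_of_slab_subset hslab₁ ht htb rfl (hj t)
  have hmid := reachable_of_slab_subset hslab (h₁ htb) (h₂ htb')
    (Function.update_self i b t) (Function.update_self i b t')
  have hend := reachable_of_slab_subset hslab₂ htb' ht' (hj t') rfl
  exact ((hstart.mono (within_mono (Set.inter_subset_inter_right P h₁))).trans hmid).trans
    (hend.mono (within_mono (Set.inter_subset_inter_right P h₂)))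

theorem exists_notMem_of_not_reachable {r : ℕ} {t v : Fin d → ℤ} (ht : t ∈ box d r)
    (hslab : ∀ i, ∀ u ∈ box d r, u i = t i → u ∈ P) (hv : v ∈ box d r)
    (hnot : ¬ (within (SimpleGraph.hasse _) (P ∩ box d r)).Reachable t v) (i : Fin d) :
    ∃ u ∈ box d r, u ∉ P ∧ ∀ k ≠ i, u k = v k := by
  by_contra! hline
  have htv : Function.update v i (t i) ∈ box d r := update_mem_box hv i (mem_box.1 ht i)
  have hline_subset : Set.uIcc (Function.update v i (t i)) v ⊆ P ∩ box d r := by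
    intro u hu
    have huQ : u ∈ box d r := by
      rw [← Finset.mem_coe, coe_box] at htv hv ⊢
      exact Set.uIcc_subset_Icc htv hv hu
    refine ⟨by_contra fun huP => ?_, huQ⟩
    obtain ⟨k, hk, hne⟩ := hline u huQ huP
    have huk : u k ∈ Set.uIcc (Function.update v i (t i) k) (v k) := ⟨hu.1 k, hu.2 k⟩
    rw [Function.update_of_ne hk, Set.uIcc_self] at huk
    exact hne huk
  refine hnot (SimpleGraph.Reachable.trans ?_ (reachable_of_uIcc_subset hline_subset))
  simp only [← Finset.mem_coe, coe_box] at hslab ht htv ⊢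
  exact reachable_of_slab_subset (hslab i) ht htv rfl (Function.update_self i (t i) v)

open Classical in
/-- A point disconnected from `t` sees a missing point on each axis-parallel line through it, and is
determined by the two missing points found in two different directions. -/
theorem card_not_reachable_le (hd : 2 ≤ d) {r k : ℕ}
    (hcard : ((box d r).filter (· ∉ P)).card ≤ k) {t : Fin d → ℤ} (ht : t ∈ box d r)
    (hslab : ∀ i, ∀ u ∈ box d r, u i = t i → u ∈ P) :
    ((box d r).filter fun v =>
      ¬ (within (SimpleGraph.hasse _) (P ∩ box d r)).Reachable t v).card ≤ k ^ 2 := by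
  have : Nontrivial (Fin d) := Fin.nontrivial_iff_two_le.2 hd
  obtain ⟨i₀, i₁, hne⟩ := exists_pair_ne (Fin d)
  set B := (box d r).filter (· ∉ P)
  have hsub : ((box d r).filter fun v =>
      ¬ (within (SimpleGraph.hasse _) (P ∩ box d r)).Reachable t v)
        ⊆ (B ×ˢ B).image fun q => Function.update q.2 i₁ (q.1 i₁) := by
    intro v hv
    obtain ⟨hv, hnot⟩ := Finset.mem_filter.1 hv
    obtain ⟨u, hu, huP, huv⟩ := exists_notMem_of_not_reachable ht hslab hv hnot i₀
    obtain ⟨u', hu', hu'P, huv'⟩ := exists_notMem_of_not_reachable ht hslab hv hnot i₁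
    refine Finset.mem_image.2 ⟨(u, u'), by simp [B, hu, huP, hu', hu'P], ?_⟩
    ext k
    rcases eq_or_ne k i₁ with rfl | hk
    · simp [huv k hne.symm]
    · simp [hk, huv' k hk]
  calc _ ≤ ((B ×ˢ B).image fun q => Function.update q.2 i₁ (q.1 i₁)).card :=
        Finset.card_le_card hsub
    _ ≤ (B ×ˢ B).card := Finset.card_image_le
    _ = B.card ^ 2 := by rw [Finset.card_product, sq]
    _ ≤ k ^ 2 := Nat.pow_le_pow_left hcard 2

end Grid

/-! ### Dirichlet forms and mixing times of graphs -/

open Classical in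
/-- The sum of `F x y` over the edges `xy` of `G`, oriented from `x ∈ s` to `y ∈ t`. An edge inside
`s ∩ t` is counted once in each direction. -/
noncomputable def dartSum {V : Type*} (G : SimpleGraph V) (s t : Finset V) (F : V → V → ℝ) : ℝ :=
  ∑ x ∈ s, ∑ y ∈ t, if G.Adj x y then F x y else 0

section DartSum

variable {V : Type*} {G H : SimpleGraph V} {s s' t t' : Finset V} {F : V → V → ℝ}

open Classical in
theorem dartSum_comm (G : SimpleGraph V) (s t : Finset V) (F : V → V → ℝ) :
    dartSum G s t F = dartSum G t s fun x y => F y x := by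
  rw [dartSum, Finset.sum_comm]
  exact Finset.sum_congr rfl fun y _ => Finset.sum_congr rfl fun x _ =>
    if_congr (G.adj_comm x y) rfl rfl

theorem dartSum_add (F F' : V → V → ℝ) :
    dartSum G s t (fun x y => F x y + F' x y) = dartSum G s t F + dartSum G s t F' := by
  simp only [dartSum, ite_add_zero, Finset.sum_add_distrib]

theorem dartSum_const_mul (c : ℝ) (F : V → V → ℝ) :
    dartSum G s t (fun x y => c * F x y) = c * dartSum G s t F := by
  simp only [dartSum, Finset.mul_sum, mul_ite, mul_zero]

theorem dartSum_nonneg (hF : ∀ x y, 0 ≤ F x y) : 0 ≤ dartSum G s t F :=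
  Finset.sum_nonneg fun x _ => Finset.sum_nonneg fun y _ => by
    split_ifs; exacts [hF x y, le_rfl]

theorem dartSum_le_dartSum {F' : V → V → ℝ} (h : ∀ x y, F x y ≤ F' x y) :
    dartSum G s t F ≤ dartSum G s t F' :=
  Finset.sum_le_sum fun x _ => Finset.sum_le_sum fun y _ => by
    split_ifs; exacts [h x y, le_rfl]

theorem dartSum_mono (hF : ∀ x y, 0 ≤ F x y) (hHG : H ≤ G) (hs : s ⊆ s') (ht : t ⊆ t') :
    dartSum H s t F ≤ dartSum G s' t' F := by
  classical
  have hnonneg : ∀ x y, 0 ≤ if G.Adj x y then F x y else 0 := fun x y => by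
    split_ifs; exacts [hF x y, le_rfl]
  calc dartSum H s t F ≤ dartSum G s t F := by
        refine Finset.sum_le_sum fun x _ => Finset.sum_le_sum fun y _ => ?_
        split_ifs with hH hG hG
        exacts [le_rfl, absurd (hHG hH) hG, hF x y, le_rfl]
    _ ≤ dartSum G s t' F := Finset.sum_le_sum fun x _ =>
        Finset.sum_le_sum_of_subset_of_nonneg ht fun y _ _ => hnonneg x y
    _ ≤ dartSum G s' t' F := Finset.sum_le_sum_of_subset_of_nonneg hs fun x _ _ =>
        Finset.sum_nonneg fun y _ => hnonneg x y

theorem dartSum_insert_le [DecidableEq V] (hF : ∀ x y, 0 ≤ F x y) (u : V) :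
    dartSum G (insert u s) t F ≤ dartSum G {u} t F + dartSum G s t F := by
  by_cases hu : u ∈ s
  · rw [Finset.insert_eq_of_mem hu]
    exact le_add_of_nonneg_left (dartSum_nonneg hF)
  · simp only [dartSum, Finset.sum_insert hu, Finset.sum_singleton, le_refl]

theorem sq_sub_le_of_reachable {N : Finset V} (hN : ∀ x y, H.Adj x y → x ∈ N) (f : V → ℝ)
    {x y : V} (hxy : H.Reachable x y) :
    (f x - f y) ^ 2 ≤ N.card * dartSum H N N fun u v => (f u - f v) ^ 2 := by
  classical
  obtain ⟨p, hp⟩ := hxy.exists_isPath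
  have htelescope : ∀ {a b : V} (q : H.Walk a b),
      f a - f b = (q.darts.map fun e => f e.fst - f e.snd).sum := by
    intro a b q
    induction q with
    | nil => simp
    | cons hadj q ih => simp [← ih]
  have hfst : (p.darts.map (·.fst)).Nodup := by
    have := hp.support_nodup
    rw [← p.map_fst_darts_append] at this
    exact (List.nodup_append.1 this).1
  have hcard : p.darts.toFinset.card ≤ N.card :=
    Finset.card_le_card_of_injOn (·.fst) (fun e _ => hN _ _ e.adj) fun e he e' he' =>
      List.inj_on_of_nodup_map hfst (List.mem_toFinset.1 he) (List.mem_toFinset.1 he')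
  have hsum : ∑ e ∈ p.darts.toFinset, (f e.fst - f e.snd) ^ 2
      ≤ dartSum H N N fun u v => (f u - f v) ^ 2 := by
    rw [dartSum, ← Finset.sum_product', ← Finset.sum_filter,
      ← Finset.sum_image (g := fun e : H.Dart => e.toProd)
        (f := fun q : V × V => (f q.1 - f q.2) ^ 2)
        fun a _ b _ hab => SimpleGraph.Dart.toProd_injective hab]
    refine Finset.sum_le_sum_of_subset_of_nonneg (Finset.image_subset_iff.2 fun e _ => ?_)
      fun _ _ _ => sq_nonneg _
    simp only [Finset.mem_filter, Finset.mem_product]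
    exact ⟨⟨hN _ _ e.adj, hN _ _ e.adj.symm⟩, e.adj⟩
  rw [htelescope p, ← List.sum_toFinset _ (p.darts_nodup_of_support_nodup hp.support_nodup)]
  refine sq_sum_le_card_mul_sum_sq.trans ?_
  gcongr

theorem sq_sub_le_of_reachable_within_insert [Fintype V] {N : Finset V} {u : V} (f : V → ℝ)
    {x y : V} (hxy : (within G (insert u N)).Reachable x y) :
    (f x - f y) ^ 2
      ≤ (N.card + 1) * (2 * dartSum G N Finset.univ fun u v => (f u - f v) ^ 2) := by
  classical
  set H := within G (insert u (N : Set V)) with hH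
  set F : V → V → ℝ := fun u v => (f u - f v) ^ 2 with hF
  set K := insert u N with hK
  have hHG : H ≤ G := fun _ _ h => (within_adj.1 h).2.2
  have hF0 : ∀ x y, 0 ≤ F x y := fun _ _ => sq_nonneg _
  have hFsymm : (fun x y => F y x) = F := funext₂ fun x y => sub_sq_comm (f y) (f x)
  have hcard : (K.card : ℝ) ≤ N.card + 1 := by exact_mod_cast Finset.card_insert_le u N
  have hloop : dartSum H {u} {u} F = 0 := by simp [dartSum]
  have hrow : dartSum H {u} K F ≤ dartSum H N {u} F := by
    rw [dartSum_comm, hFsymm]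
    linarith [dartSum_insert_le (G := H) (s := N) (t := {u}) hF0 u]
  have hsum : dartSum H K K F ≤ 2 * dartSum G N Finset.univ F := by
    have h₁ := dartSum_mono hF0 hHG (subset_refl N) (Finset.subset_univ {u})
    have h₂ := dartSum_mono hF0 hHG (subset_refl N) (Finset.subset_univ K)
    linarith [dartSum_insert_le (G := H) (s := N) (t := K) hF0 u]
  refine (sq_sub_le_of_reachable (N := K) (fun a b hab => ?_) f hxy).trans
    (mul_le_mul hcard hsum (dartSum_nonneg hF0) (by positivity))
  simpa [hK] using (within_adj.1 hab).1

end DartSum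

section Energy

variable {V : Type*} [Fintype V] (G : SimpleGraph V) (f : V → ℝ)

/-- Twice the Dirichlet form of `f`, each edge being counted in both directions. -/
noncomputable def energy : ℝ := dartSum G Finset.univ Finset.univ fun x y => (f x - f y) ^ 2

/-- The quadratic form of the signless Laplacian, with the normalization of `energy`. -/
noncomputable def signlessEnergy : ℝ :=
  dartSum G Finset.univ Finset.univ fun x y => (f x + f y) ^ 2

theorem signlessEnergy_nonneg : 0 ≤ signlessEnergy G f := dartSum_nonneg fun _ _ => sq_nonneg _

theorem energy_abs_le_signlessEnergy : energy G (fun x => |f x|) ≤ signlessEnergy G f :=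
  dartSum_le_dartSum fun x y => sq_le_sq.2 (by
    simpa only [abs_neg, sub_neg_eq_add] using abs_abs_sub_abs_le (f x) (-f y))

open Classical in
theorem sum_degree_mul_eq_dartSum :
    ∑ x, (G.degree x : ℝ) * f x = dartSum G Finset.univ Finset.univ fun x _ => f x := by
  refine Finset.sum_congr rfl fun x _ => ?_
  rw [← Finset.sum_filter, Finset.sum_const, nsmul_eq_mul,
    ← SimpleGraph.neighborFinset_eq_filter, SimpleGraph.card_neighborFinset_eq_degree]

open Classical in
theorem dartSum_sq_add_mul (s : ℝ) :
    dartSum G Finset.univ Finset.univ (fun x y => (f x + s * f y) ^ 2)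
      = (1 + s ^ 2) * ∑ x, (G.degree x : ℝ) * f x ^ 2
        + 2 * s * (f ⬝ᵥ G.adjMatrix ℝ *ᵥ f) := by
  have hfst := sum_degree_mul_eq_dartSum G fun x => f x ^ 2
  have hsnd := hfst.trans (dartSum_comm _ _ _ _)
  have hcross : f ⬝ᵥ G.adjMatrix ℝ *ᵥ f
      = dartSum G Finset.univ Finset.univ fun x y => f x * f y := by
    simp only [dotProduct, Matrix.mulVec, SimpleGraph.adjMatrix_apply, dartSum, Finset.mul_sum,
      ite_mul, mul_ite, one_mul, zero_mul, mul_zero]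
  have hsq : ∀ x y, (f x + s * f y) ^ 2 = f x ^ 2 + (s ^ 2 * f y ^ 2 + 2 * s * (f x * f y)) :=
    fun x y => by ring
  simp only [hsq, dartSum_add, dartSum_const_mul, ← hfst, ← hsnd, hcross]
  ring

open Classical in
theorem abs_dotProduct_adjMatrix_mulVec_le {A : ℝ} (hA : 0 < A)
    (henergy : ∑ x, (G.degree x : ℝ) * f x ^ 2 ≤ A * energy G f)
    (hsignless : ∑ x, (G.degree x : ℝ) * f x ^ 2 ≤ A * signlessEnergy G f) :
    |f ⬝ᵥ G.adjMatrix ℝ *ᵥ f| ≤ (1 - 1 / (2 * A)) * ∑ x, (G.degree x : ℝ) * f x ^ 2 := by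
  have hminus := dartSum_sq_add_mul G f (-1)
  have hplus := dartSum_sq_add_mul G f 1
  simp only [neg_one_mul, ← sub_eq_add_neg, one_mul] at hminus hplus
  have hscale : ∀ E, ∑ x, (G.degree x : ℝ) * f x ^ 2 ≤ A * E →
      1 / (2 * A) * ∑ x, (G.degree x : ℝ) * f x ^ 2 ≤ E / 2 := by
    intro E hE
    rw [one_div_mul_eq_div, div_le_iff₀ (by positivity)]
    linarith
  have hminus_le := hscale _ henergy
  have hplus_le := hscale _ hsignless
  rw [energy] at hminus_le
  rw [signlessEnergy] at hplus_le
  rw [abs_le]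
  constructor <;> linarith

end Energy

theorem one_sub_pow_le_one_div_sq {A : ℝ} (hA : 1 ≤ A) {n t : ℕ} (hn : 0 < n)
    (ht : 4 * A * Real.log n ≤ t) : (1 - 1 / (2 * A)) ^ t ≤ 1 / (n : ℝ) ^ 2 := by
  have hle : 1 / (2 * A) ≤ 1 := by
    rw [div_le_one (by positivity)]
    linarith
  calc (1 - 1 / (2 * A)) ^ t ≤ Real.exp (-(1 / (2 * A))) ^ t :=
        pow_le_pow_left₀ (sub_nonneg.2 hle) (Real.one_sub_le_exp_neg _) t
    _ = Real.exp (-(t / (2 * A))) := by rw [← Real.exp_nat_mul]; ring_nf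
    _ ≤ Real.exp (-(2 * Real.log n)) := by
        gcongr
        rw [le_div_iff₀ (by positivity)]
        linarith
    _ = 1 / (n : ℝ) ^ 2 := by
        rw [Real.exp_neg, mul_comm, Real.exp_mul, Real.exp_log (by positivity), one_div,
          Real.rpow_two]

section MixingTime

variable {V : Type*} [Fintype V] {G : SimpleGraph V}

open Classical in
theorem conductance_adjMatrix (G : SimpleGraph V) (x : V) :
    ReversibleChain.conductance (G.adjMatrix ℝ) x = G.degree x := by
  simp only [ReversibleChain.conductance, SimpleGraph.adjMatrix_apply, Finset.sum_boole,
    ← SimpleGraph.neighborFinset_eq_filter, SimpleGraph.card_neighborFinset_eq_degree]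

open Classical in
theorem transition_adjMatrix (G : SimpleGraph V) :
    ReversibleChain.transition (G.adjMatrix ℝ) = G.walkMatrix := by
  ext x y
  simp [ReversibleChain.transition, SimpleGraph.walkMatrix, conductance_adjMatrix, ite_div]

variable [DecidableEq V]

theorem mixingTime_le_of_walkDist_le {δ : ℝ} {T : ℕ}
    (h : ∀ i, ∀ t ≥ T, G.walkDist i t ≤ δ) : G.mixingTime δ ≤ T :=
  iSup_le fun i => iInf₂_le T (h i)

open Classical in
theorem walkDist_le_of_abs_dotProduct_le (hdeg : ∀ x, 0 < G.degree x) {l : ℝ} (hl : 0 < l)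
    (hform : ∀ f : V → ℝ, ∑ x, (G.degree x : ℝ) * f x = 0 →
      |f ⬝ᵥ G.adjMatrix ℝ *ᵥ f| ≤ l * ∑ x, (G.degree x : ℝ) * f x ^ 2) (i : V) (t : ℕ) :
    G.walkDist i t ≤ Fintype.card V * l ^ t := by
  have hsum : ∑ x, (G.degree x : ℝ) = 2 * (G.edgeFinset.card : ℝ) := by
    exact_mod_cast G.sum_degrees_eq_twice_card_edges
  have hsum_le : ∑ x, (G.degree x : ℝ) ≤ (Fintype.card V : ℝ) ^ 2 := by
    calc ∑ x, (G.degree x : ℝ) ≤ ∑ _x : V, (Fintype.card V : ℝ) :=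
          Finset.sum_le_sum fun x _ => by exact_mod_cast (G.degree_lt_card_verts x).le
      _ = (Fintype.card V : ℝ) ^ 2 := by simp [sq]
  have hchain := ReversibleChain.sum_abs_transition_pow_sub_le (W := G.adjMatrix ℝ)
    G.isSymm_adjMatrix (by simpa only [conductance_adjMatrix, Nat.cast_pos] using hdeg) hl
    (by simpa only [conductance_adjMatrix] using hform) i t
  simp only [conductance_adjMatrix, transition_adjMatrix] at hchain
  have hsqrt : √((∑ x, (G.degree x : ℝ)) / G.degree i) ≤ Fintype.card V := by
    refine Real.sqrt_le_iff.2 ⟨Nat.cast_nonneg _, (div_le_self ?_ ?_).trans hsum_le⟩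
    · exact Finset.sum_nonneg fun _ _ => Nat.cast_nonneg _
    · exact_mod_cast hdeg i
  calc G.walkDist i t ≤ ∑ j, |(G.walkMatrix ^ t) i j - G.degree j / ∑ x, (G.degree x : ℝ)| := by
        rw [SimpleGraph.walkDist, hsum]
        refine mul_le_of_le_one_left (Finset.sum_nonneg fun _ _ => abs_nonneg _) (by norm_num)
    _ ≤ √((∑ x, (G.degree x : ℝ)) / G.degree i) * l ^ t := hchain
    _ ≤ Fintype.card V * l ^ t := by gcongr

open Classical in
theorem mixingTime_le_of_poincare (hG : G.Connected) (hV : 2 ≤ Fintype.card V) {A : ℝ}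
    (hA : 1 ≤ A)
    (henergy : ∀ f : V → ℝ, ∑ x, (G.degree x : ℝ) * f x = 0 →
      ∑ x, (G.degree x : ℝ) * f x ^ 2 ≤ A * energy G f)
    (hsignless : ∀ f : V → ℝ, ∑ x, (G.degree x : ℝ) * f x ^ 2 ≤ A * signlessEnergy G f)
    {T : ℕ} (hT : 4 * A * Real.log (Fintype.card V) ≤ T) :
    G.mixingTime (1 / (Fintype.card V : ℝ)) ≤ T := by
  have hcard : 0 < Fintype.card V := by omega
  have : Nontrivial V := Fintype.one_lt_card_iff_nontrivial.1 (by omega)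
  have hl : 0 < 1 - 1 / (2 * A) := by
    rw [sub_pos, div_lt_one (by positivity)]
    linarith
  refine mixingTime_le_of_walkDist_le fun i t ht => ?_
  calc G.walkDist i t ≤ Fintype.card V * (1 - 1 / (2 * A)) ^ t :=
        walkDist_le_of_abs_dotProduct_le (fun x => hG.preconnected.degree_pos_of_nontrivial x) hl
          (fun f hf => abs_dotProduct_adjMatrix_mulVec_le G f (by positivity) (henergy f hf)
            (hsignless f)) i t
    _ ≤ Fintype.card V * (1 / (Fintype.card V : ℝ) ^ 2) := by
        gcongr
        exact one_sub_pow_le_one_div_sq hA hcard (hT.trans (by exact_mod_cast ht))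
    _ = 1 / (Fintype.card V : ℝ) := by field_simp

end MixingTime

/-! ### Geometry of the flat torus -/

namespace GTG

section ToricDist

variable {d : ℕ} {x y z : UnitAddTorus (Fin d)}

theorem toricDist_nonneg (x y : UnitAddTorus (Fin d)) : 0 ≤ toricDist x y := Real.sqrt_nonneg _

theorem toricDist_comm (x y : UnitAddTorus (Fin d)) : toricDist x y = toricDist y x := by
  simp only [toricDist, norm_sub_rev]

theorem toricDist_eq_norm (x y : UnitAddTorus (Fin d)) :
    toricDist x y = ‖WithLp.toLp 2 (fun i => ‖x i - y i‖)‖ := by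
  simp [toricDist, EuclideanSpace.norm_eq]

theorem toricDist_triangle (x y z : UnitAddTorus (Fin d)) :
    toricDist x z ≤ toricDist x y + toricDist y z := by
  rw [toricDist_eq_norm x y, toricDist_eq_norm y z]
  refine le_trans ?_ (norm_add_le _ _)
  rw [EuclideanSpace.norm_eq]
  refine Real.sqrt_le_sqrt (Finset.sum_le_sum fun i _ => pow_le_pow_left₀ (norm_nonneg _) ?_ 2)
  exact (norm_sub_le_norm_sub_add_norm_sub (x i) (y i) (z i)).trans (le_abs_self _)

theorem norm_sub_le_toricDist (x y : UnitAddTorus (Fin d)) : ‖x - y‖ ≤ toricDist x y :=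
  (pi_norm_le_iff_of_nonneg (toricDist_nonneg x y)).2 fun i => Real.le_sqrt_of_sq_le <|
    Finset.single_le_sum (f := fun i => ‖x i - y i‖ ^ 2) (fun _ _ => sq_nonneg _)
      (Finset.mem_univ i)

theorem toricDist_le_of_forall_norm_le {a b : UnitAddTorus (Fin d)} {l : ℝ} (hl : 0 ≤ l)
    (h : ∀ i, ‖a i - b i‖ ≤ l * ‖x i - y i‖) : toricDist a b ≤ l * toricDist x y := by
  refine Real.sqrt_le_iff.2 ⟨mul_nonneg hl (toricDist_nonneg x y), ?_⟩
  rw [toricDist, mul_pow, Real.sq_sqrt (Finset.sum_nonneg fun _ _ => sq_nonneg _), Finset.mul_sum]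
  refine Finset.sum_le_sum fun i _ => ?_
  rw [← mul_pow]
  exact pow_le_pow_left₀ (norm_nonneg _) (h i) 2

theorem toricDist_le_mul_norm (x y : UnitAddTorus (Fin d)) : toricDist x y ≤ d * ‖x - y‖ := by
  refine Real.sqrt_le_iff.2 ⟨by positivity, ?_⟩
  calc ∑ i, ‖x i - y i‖ ^ 2 ≤ ∑ _i : Fin d, ‖x - y‖ ^ 2 :=
        Finset.sum_le_sum fun i _ => pow_le_pow_left₀ (norm_nonneg _) (norm_le_pi_norm (x - y) i) 2
    _ = d * ‖x - y‖ ^ 2 := by simp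
    _ ≤ d ^ 2 * ‖x - y‖ ^ 2 := by
        gcongr
        exact_mod_cast Nat.le_self_pow two_ne_zero d
    _ = (d * ‖x - y‖) ^ 2 := (mul_pow _ _ _).symm

theorem exists_coe_eq_and_abs_eq_norm (u : UnitAddCircle) :
    ∃ t : ℝ, (t : UnitAddCircle) = u ∧ |t| = ‖u‖ := by
  induction u using QuotientAddGroup.induction_on with
  | H t =>
    have hround : ((round t : ℝ) : UnitAddCircle) = 0 :=
      (AddCircle.coe_eq_zero_iff 1).2 ⟨round t, by simp⟩
    refine ⟨t - round t, ?_, UnitAddCircle.norm_eq.symm⟩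
    rw [AddCircle.coe_sub, hround, sub_zero]

theorem norm_coe_le_abs (t : ℝ) : ‖(t : UnitAddCircle)‖ ≤ |t| :=
  QuotientAddGroup.norm_mk_le_norm

theorem exists_toricDist_le_mul_and_le_one_sub_mul (x y : UnitAddTorus (Fin d)) {l : ℝ}
    (hl : 0 ≤ l) (hl1 : l ≤ 1) :
    ∃ q, toricDist x q ≤ l * toricDist x y ∧ toricDist q y ≤ (1 - l) * toricDist x y := by
  choose t ht htn using fun i => exists_coe_eq_and_abs_eq_norm (y i - x i)
  have hnorm : ∀ {k : ℝ}, 0 ≤ k → ∀ i, ‖((k * t i : ℝ) : UnitAddCircle)‖ ≤ k * ‖x i - y i‖ := by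
    intro k hk i
    rw [norm_sub_rev, ← htn, ← abs_of_nonneg hk, ← abs_mul, abs_of_nonneg hk]
    exact norm_coe_le_abs _
  refine ⟨fun i => x i + ((l * t i : ℝ) : UnitAddCircle),
    toricDist_le_of_forall_norm_le hl fun i => ?_,
    toricDist_le_of_forall_norm_le (sub_nonneg.2 hl1) fun i => ?_⟩
  · rw [sub_add_cancel_left, norm_neg]
    exact hnorm hl i
  · have hy : x i + ((l * t i : ℝ) : UnitAddCircle) - y i
        = -(((1 - l) * t i : ℝ) : UnitAddCircle) := by
      rw [one_sub_mul, AddCircle.coe_sub, ht]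
      abel
    rw [hy, norm_neg]
    exact hnorm (sub_nonneg.2 hl1) i

end ToricDist

/-! ### The lattice of mesh `1 / M` in the torus -/

section Lattice

variable {d M : ℕ}

/-- Reduction modulo `M` of an integer vector: displacements of lattice points are measured by
integer vectors, the lattice points themselves are indexed by residues. -/
def red (M : ℕ) (v : Fin d → ℤ) : Fin d → ZMod M := fun i => v i

theorem red_add (v w : Fin d → ℤ) : red M (v + w) = red M v + red M w := by
  ext i
  simp [red]

theorem red_single (j : Fin d) : red M (Pi.single j 1) = Pi.single j 1 := by
  ext i
  obtain rfl | h := eq_or_ne i j <;> simp [red, *]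

/-- The side length of the cells when each side of the torus is divided into `M` intervals. -/
noncomputable def mesh (M : ℕ) : ℝ := 1 / M

variable [NeZero M]

theorem mesh_pos : 0 < mesh M := one_div_pos.2 (Nat.cast_pos.2 (NeZero.pos M))

/-- The point of the torus with coordinates `a i / M`, a vertex of the lattice of mesh `1 / M`. -/
noncomputable def pt (a : Fin d → ZMod M) : UnitAddTorus (Fin d) := fun i => ZMod.toAddCircle (a i)

theorem pt_add_red_apply (a : Fin d → ZMod M) (v : Fin d → ℤ) (i : Fin d) :
    pt (a + red M v) i = pt a i + ((v i / M : ℝ) : UnitAddCircle) := by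
  simp only [pt, red, Pi.add_apply, map_add, ZMod.toAddCircle_intCast]

theorem norm_pt_add_red_sub_le (a : Fin d → ZMod M) {v : Fin d → ℤ} {r : ℕ}
    (hv : v ∈ Grid.box d r) : ‖pt (a + red M v) - pt a‖ ≤ r * mesh M := by
  refine (pi_norm_le_iff_of_nonneg (mul_nonneg r.cast_nonneg mesh_pos.le)).2 fun i => ?_
  rw [Pi.sub_apply, pt_add_red_apply, add_sub_cancel_left, mesh, mul_one_div]
  refine (norm_coe_le_abs _).trans ?_
  rw [abs_div, Nat.abs_cast]
  gcongr
  exact_mod_cast abs_le.2 (Grid.mem_box.1 hv i)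

theorem exists_mem_box_norm_sub_pt_le (a : Fin d → ZMod M) {q : UnitAddTorus (Fin d)} {r : ℕ}
    (hq : ‖q - pt a‖ ≤ r * mesh M) :
    ∃ v ∈ Grid.box d (r + 1), ‖q - pt (a + red M v)‖ ≤ mesh M := by
  have hM : (0 : ℝ) < M := Nat.cast_pos.2 (NeZero.pos M)
  choose t ht htn using fun i => exists_coe_eq_and_abs_eq_norm (q i - pt a i)
  have hround : ∀ i, |t i * M - round (t i * M)| ≤ 1 := fun i =>
    (abs_sub_round _).trans (by norm_num)
  refine ⟨fun i => round (t i * M), Grid.mem_box.2 fun i => ?_,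
    (pi_norm_le_iff_of_nonneg mesh_pos.le).2 fun i => ?_⟩
  · have htr : |t i * M| ≤ r := by
      rw [mesh, mul_one_div] at hq
      rw [abs_mul, abs_of_pos hM, ← le_div_iff₀ hM, htn]
      exact (norm_le_pi_norm (q - pt a) i).trans hq
    have habs : |(round (t i * M) : ℝ)| ≤ r + 1 := by
      have := abs_sub_abs_le_abs_sub (round (t i * M) : ℝ) (t i * M)
      rw [abs_sub_comm] at this
      linarith [hround i]
    exact_mod_cast abs_le.1 habs
  · have hdiff : t i - (round (t i * M) : ℝ) / M = (t i * M - round (t i * M)) / M := by field_simp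
    rw [Pi.sub_apply, pt_add_red_apply, ← sub_sub, ← ht, ← AddCircle.coe_sub, hdiff]
    refine (norm_coe_le_abs _).trans ?_
    rw [abs_div, abs_of_pos hM, mesh]
    gcongr
    exact hround i

theorem exists_norm_sub_pt_le (q : UnitAddTorus (Fin d)) :
    ∃ a : Fin d → ZMod M, ‖q - pt a‖ ≤ mesh M := by
  have hM : (0 : ℝ) < M := Nat.cast_pos.2 (NeZero.pos M)
  obtain ⟨r, hr⟩ := exists_nat_ge (‖q - pt (0 : Fin d → ZMod M)‖ * M)
  obtain ⟨v, -, hv⟩ := exists_mem_box_norm_sub_pt_le 0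
    (by rwa [mesh, mul_one_div, le_div_iff₀ hM])
  exact ⟨_, hv⟩

theorem exists_intCast_eq_and_norm_toAddCircle_eq (u : ZMod M) :
    ∃ k : ℤ, (k : ZMod M) = u ∧ ‖ZMod.toAddCircle u‖ = |k| / M := by
  have hM : (0 : ℝ) < M := Nat.cast_pos.2 (NeZero.pos M)
  refine ⟨u.val - round (u.val / M : ℝ) * M, by simp, ?_⟩
  have hk : (u.val / M : ℝ) - round (u.val / M : ℝ)
      = (u.val - round (u.val / M : ℝ) * M : ℤ) / M := by
    push_cast
    field_simp
  rw [ZMod.toAddCircle_apply, UnitAddCircle.norm_eq, hk, abs_div, abs_of_pos hM, Int.cast_abs]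

theorem exists_mem_box_add_red_eq {a b : Fin d → ZMod M} {r : ℕ}
    (h : ‖pt b - pt a‖ ≤ r * mesh M) :
    ∃ v ∈ Grid.box d r, a + red M v = b := by
  have hM : (0 : ℝ) < M := Nat.cast_pos.2 (NeZero.pos M)
  choose v hv hvn using fun i => exists_intCast_eq_and_norm_toAddCircle_eq (b i - a i)
  refine ⟨v, Grid.mem_box.2 fun i => ?_, funext fun i => ?_⟩
  · have hle := (norm_le_pi_norm (pt b - pt a) i).trans h
    rw [Pi.sub_apply, pt, pt, ← map_sub, hvn, mesh, mul_one_div,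
      div_le_div_iff_of_pos_right hM] at hle
    exact abs_le.1 (by exact_mod_cast hle)
  · rw [Pi.add_apply, red, hv, add_sub_cancel]

open Classical in
theorem card_filter_norm_sub_pt_le (q : UnitAddTorus (Fin d)) (r : ℕ) :
    (Finset.univ.filter fun a : Fin d → ZMod M => ‖q - pt a‖ ≤ r * mesh M).card
      ≤ (Grid.box d (2 * r : ℕ)).card := by
  obtain h | ⟨a₀, ha₀⟩ := (Finset.univ.filter fun a : Fin d → ZMod M =>
    ‖q - pt a‖ ≤ r * mesh M).eq_empty_or_nonempty
  · simp only [h, Finset.card_empty, zero_le]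
  refine (Finset.card_le_card (t := (Grid.box d (2 * r : ℕ)).image fun v => a₀ + red M v)
    fun a ha => ?_).trans Finset.card_image_le
  rw [Finset.mem_filter] at ha ha₀
  have hdist : ‖pt a - pt a₀‖ ≤ (2 * r : ℕ) * mesh M := by
    have htri := norm_sub_le_norm_sub_add_norm_sub (pt a) q (pt a₀)
    rw [norm_sub_rev (pt a) q] at htri
    push_cast
    linarith [ha.2, ha₀.2]
  exact Finset.mem_image.2 (exists_mem_box_add_red_eq hdist)

end Lattice

end GTG

/-! ### Regular configurations are locally connected -/

theorem exists_adj_notMem_and_reachable_within {V : Type*} {G : SimpleGraph V} {S : Set V} {x y : V}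
    (hxy : G.Reachable x y) (hx : x ∈ S) (hy : y ∉ S) :
    ∃ z ∈ S, ∃ u ∉ S, G.Adj z u ∧ (within G S).Reachable x z := by
  obtain ⟨p⟩ := hxy
  obtain ⟨e, -, ⟨hfst, hreach⟩, hsnd⟩ := p.exists_boundary_dart
    {z | z ∈ S ∧ (within G S).Reachable x z} ⟨hx, SimpleGraph.Reachable.rfl⟩ fun h => hy h.1
  refine ⟨e.fst, hfst, e.snd, fun hS => hsnd ⟨hS, hreach.trans ?_⟩, e.adj, hreach⟩
  exact (within_adj.2 ⟨hfst, hS, e.adj⟩ : (within G S).Adj e.fst e.snd).reachable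

namespace Grid

variable {d : ℕ}

theorem sub_mem_box_of_hasse_adj {u v : Fin d → ℤ} (h : (SimpleGraph.hasse _).Adj u v) :
    u - v ∈ box d 1 := by
  refine mem_box.2 fun k => ?_
  rw [SimpleGraph.hasse_adj, Pi.covBy_iff, Pi.covBy_iff] at h
  simp only [Order.covBy_iff_add_one_eq] at h
  rw [Pi.sub_apply]
  obtain ⟨i, hi, hne⟩ | ⟨i, hi, hne⟩ := h <;>
    obtain rfl | hk := eq_or_ne k i
  · omega
  · have := hne k hk
    omega
  · omega
  · have := hne k hk
    omega

open Classical in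
theorem exists_add_mem_of_card_le [NeZero d] {R s k : ℕ} {C : Set (Fin d → ℤ)}
    (hcard : ((box d R).filter (· ∉ C)).card ≤ k) {v : Fin d → ℤ} (hv : v ∈ box d s)
    (hR : s + k ≤ R) : ∃ w ∈ box d k, v + w ∈ C := by
  by_contra! hcon
  have hmaps : ∀ j ∈ Finset.range (k + 1),
      v + Pi.single 0 (j : ℤ) ∈ (box d R).filter (· ∉ C) := fun j hj => by
    have hjk : j ≤ k := Nat.lt_succ_iff.1 (Finset.mem_range.1 hj)
    have hsingle := box_mono hjk (single_mem_box (0 : Fin d) j)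
    exact Finset.mem_filter.2 ⟨box_mono hR (add_mem_box hv hsingle), hcon _ hsingle⟩
  have hinj : Set.InjOn (fun j : ℕ => v + Pi.single 0 (j : ℤ)) (Finset.range (k + 1)) :=
    fun i _ j _ hij => by simpa using congrFun (add_left_cancel hij) 0
  have := Finset.card_le_card_of_injOn _ hmaps hinj
  rw [Finset.card_range] at this
  omega

end Grid

namespace GTG

variable {d n M : ℕ} [NeZero M]

open Classical in
/-- The nodes of weight at least `m₀` close to the lattice point of index `a`. Any two of them, or
of two clusters at neighbouring lattice points, are adjacent in a regular configuration. -/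
noncomputable def cluster (ω : Config d n) (m₀ : ℝ) (a : Fin d → ZMod M) : Finset (Fin n) :=
  Finset.univ.filter fun x => m₀ ≤ (ω x).2 ∧ ‖(ω x).1 - pt a‖ ≤ mesh M / 3

open Classical in
/-- The nodes at sup-distance at most `r` meshes from the lattice point of index `a`. -/
noncomputable def near (ω : Config d n) (a : Fin d → ZMod M) (r : ℕ) : Finset (Fin n) :=
  Finset.univ.filter fun x => ‖(ω x).1 - pt a‖ ≤ r * mesh M

/-- The displacements from `a` to the lattice points whose cluster has at least `ℓ` nodes. -/
def populated (ω : Config d n) (m₀ ℓ : ℝ) (a : Fin d → ZMod M) : Set (Fin d → ℤ) :=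
  {v | ℓ ≤ (cluster ω m₀ (a + red M v)).card}

/-- The maximal length, in meshes, of an edge joining two nodes that are not attached to the local
backbone; see `Regular.norm_sub_le_of_notMem_attached`. -/
def hopRadius (d k₀ : ℕ) : ℕ := 2 * d * (k₀ ^ 2 + 2)

/-- The radius, in meshes, at which connected sets of nodes not attached to the local backbone are
confined. -/
def trapRadius (d k₀ : ℕ) : ℕ := (k₀ ^ 2 + 1) * (hopRadius d k₀ + 3)

/-- The radius, in meshes, of the neighbourhoods used in local arguments. -/
def localRadius (d k₀ : ℕ) : ℕ := trapRadius d k₀ + hopRadius d k₀ + k₀ ^ 2 + k₀ + 2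

/-- The deterministic features of a typical configuration: weights are nonnegative, a node of weight
`m₀` reaches all nodes within two meshes, and in every local neighbourhood all but `k₀` lattice
points have clusters of at least `ℓ` nodes. -/
structure Regular (ω : Config d n) (M : ℕ) [NeZero M] (θ m₀ ℓ : ℝ) (k₀ : ℕ) : Prop where
  two_le_dim : 2 ≤ d
  weight_nonneg : ∀ x, 0 ≤ (ω x).2
  theta_pos : 0 < θ
  range_le : θ * (d * (2 * mesh M)) ^ d ≤ m₀
  one_le : 1 ≤ ℓ
  sparse : ∀ a : Fin d → ZMod M, (open Classical in
    (Grid.box d (localRadius d k₀ + 1)).filter (· ∉ populated ω m₀ ℓ a)).card ≤ k₀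

/-- A point `t` such that the cube of radius `localRadius d k₀` around `a` is populated on each of
the coordinate hyperplanes through `t`. -/
structure IsCrossing (ω : Config d n) (m₀ ℓ : ℝ) (k₀ : ℕ) (a : Fin d → ZMod M)
    (t : Fin d → ℤ) : Prop where
  mem_Icc : ∀ i, 0 ≤ t i ∧ t i ≤ k₀
  slab : ∀ i, ∀ v ∈ Grid.box d (localRadius d k₀), v i = t i → v ∈ populated ω m₀ ℓ a

/-- The points of the local cube that populated lattice points connect to the crossing point `t`. -/
def core (ω : Config d n) (m₀ ℓ : ℝ) (k₀ : ℕ) (a : Fin d → ZMod M) (t : Fin d → ℤ) :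
    Set (Fin d → ℤ) :=
  {v | (within (SimpleGraph.hasse _)
    (populated ω m₀ ℓ a ∩ Grid.box d (localRadius d k₀))).Reachable t v}

/-- The local backbone: the nodes of the clusters at core points. -/
def backbone (ω : Config d n) (m₀ ℓ : ℝ) (k₀ : ℕ) (a : Fin d → ZMod M) (t : Fin d → ℤ) :
    Set (Fin n) :=
  {b | ∃ v ∈ core ω m₀ ℓ k₀ a t, b ∈ cluster ω m₀ (a + red M v)}

/-- The nodes that belong to the local backbone or have a neighbour in it. -/
def attached (ω : Config d n) (θ m₀ ℓ : ℝ) (k₀ : ℕ) (a : Fin d → ZMod M) (t : Fin d → ℤ) :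
    Set (Fin n) :=
  {x | ∃ b ∈ backbone ω m₀ ℓ k₀ a t, x = b ∨ (graph θ ω).Adj x b}

section Clusters

variable {ω : Config d n} {θ m₀ ℓ : ℝ} {k₀ : ℕ} {a c c' : Fin d → ZMod M} {t v : Fin d → ℤ}
  {x b b' : Fin n} {q : UnitAddTorus (Fin d)}

theorem mem_cluster : x ∈ cluster ω m₀ a ↔ m₀ ≤ (ω x).2 ∧ ‖(ω x).1 - pt a‖ ≤ mesh M / 3 := by
  simp [cluster]

theorem mem_near {r : ℕ} : x ∈ near ω a r ↔ ‖(ω x).1 - pt a‖ ≤ r * mesh M := by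
  simp [near]

theorem near_mono {r s : ℕ} (h : r ≤ s) : near ω a r ⊆ near ω a s := fun x hx => by
  have := mesh_pos (M := M)
  exact mem_near.2 ((mem_near.1 hx).trans (by gcongr))

theorem cluster_subset_near {r : ℕ} (hv : v ∈ Grid.box d r) :
    cluster ω m₀ (a + red M v) ⊆ near ω a (r + 1) := fun b hb => by
  have hpt := norm_pt_add_red_sub_le a hv
  have htri := norm_sub_le_norm_sub_add_norm_sub (ω b).1 (pt (a + red M v)) (pt a)
  rw [mem_near, Nat.cast_succ]
  linarith [(mem_cluster.1 hb).2, mesh_pos (M := M)]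

theorem cluster_nonempty (hℓ : 1 ≤ ℓ) (hv : v ∈ populated ω m₀ ℓ a) :
    (cluster ω m₀ (a + red M v)).Nonempty :=
  Finset.card_pos.1 (Nat.cast_pos.1 (zero_lt_one.trans_le (hℓ.trans hv)))

theorem toricDist_le_of_mem_cluster (hb : b ∈ cluster ω m₀ c) {r : ℝ}
    (hq : ‖q - pt c‖ ≤ r * mesh M) : toricDist q (ω b).1 ≤ d * ((r + 1 / 3) * mesh M) := by
  refine (toricDist_le_mul_norm _ _).trans (mul_le_mul_of_nonneg_left ?_ d.cast_nonneg)
  have htri := norm_sub_le_norm_sub_add_norm_sub q (pt c) (ω b).1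
  rw [norm_sub_rev (pt c)] at htri
  linarith [(mem_cluster.1 hb).2]

theorem Regular.eq_or_adj_of_norm_sub_le (h : Regular ω M θ m₀ ℓ k₀) (hb : b ∈ cluster ω m₀ c)
    (hx : ‖(ω x).1 - pt c‖ ≤ 5 / 3 * mesh M) : x = b ∨ (graph θ ω).Adj x b := by
  refine or_iff_not_imp_left.2 fun hne => ⟨hne, ?_⟩
  calc θ * toricDist (ω x).1 (ω b).1 ^ d ≤ θ * (d * (2 * mesh M)) ^ d := by
        have := h.theta_pos
        have := toricDist_nonneg (ω x).1 (ω b).1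
        gcongr
        exact (toricDist_le_of_mem_cluster hb hx).trans_eq (by norm_num)
    _ ≤ (ω b).2 := h.range_le.trans (mem_cluster.1 hb).1
    _ ≤ (ω x).2 + (ω b).2 := le_add_of_nonneg_left (h.weight_nonneg x)

theorem Regular.eq_or_adj_of_mem_cluster (h : Regular ω M θ m₀ ℓ k₀) (hb : b ∈ cluster ω m₀ c)
    (hb' : b' ∈ cluster ω m₀ c') (hcc : ‖pt c - pt c'‖ ≤ mesh M) :
    b = b' ∨ (graph θ ω).Adj b b' := by
  refine h.eq_or_adj_of_norm_sub_le hb' ?_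
  have htri := norm_sub_le_norm_sub_add_norm_sub (ω b).1 (pt c) (pt c')
  linarith [(mem_cluster.1 hb).2, mesh_pos (M := M)]

theorem norm_pt_sub_pt_le_of_hasse_adj (a : Fin d → ZMod M) {u v : Fin d → ℤ}
    (huv : (SimpleGraph.hasse _).Adj u v) :
    ‖pt (a + red M u) - pt (a + red M v)‖ ≤ mesh M := by
  have hle := norm_pt_add_red_sub_le (a + red M v) (Grid.sub_mem_box_of_hasse_adj huv)
  rwa [add_assoc, ← red_add, add_sub_cancel, Nat.cast_one, one_mul] at hle

theorem reachable_within_of_eq_or_adj {S : Set (Fin n)} (hx : x ∈ S) (hb : b ∈ S)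
    (h : x = b ∨ (graph θ ω).Adj x b) : (within (graph θ ω) S).Reachable x b := by
  obtain rfl | h := h
  · rfl
  · exact (within_adj.2 ⟨hx, hb, h⟩ : (within (graph θ ω) S).Adj x b).reachable

theorem Regular.reachable_of_mem_cluster (h : Regular ω M θ m₀ ℓ k₀) {r : ℕ} {u : Fin d → ℤ}
    (hu : u ∈ Grid.box d r)
    (huv : (within (SimpleGraph.hasse _) (populated ω m₀ ℓ a ∩ Grid.box d r)).Reachable u v)
    (hb : b ∈ cluster ω m₀ (a + red M u)) (hb' : b' ∈ cluster ω m₀ (a + red M v)) :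
    (within (graph θ ω) (near ω a (r + 1))).Reachable b b' := by
  obtain ⟨p⟩ := huv
  induction p generalizing b with
  | nil =>
    exact reachable_within_of_eq_or_adj (cluster_subset_near hu hb) (cluster_subset_near hu hb')
      (h.eq_or_adj_of_mem_cluster hb hb' (by simpa using mesh_pos.le))
  | cons hadj _ ih =>
    obtain ⟨-, ⟨hpop, hbox⟩, hadj⟩ := within_adj.1 hadj
    obtain ⟨b₁, hb₁⟩ := cluster_nonempty h.one_le hpop
    exact (reachable_within_of_eq_or_adj (cluster_subset_near hu hb) (cluster_subset_near hbox hb₁)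
      (h.eq_or_adj_of_mem_cluster hb hb₁ (norm_pt_sub_pt_le_of_hasse_adj a hadj))).trans
      (ih hbox hb₁ hb')

end Clusters

section Crossing

variable {ω : Config d n} {θ m₀ ℓ : ℝ} {k₀ : ℕ} {a : Fin d → ZMod M} {t : Fin d → ℤ}
  {x y : Fin n} {q : UnitAddTorus (Fin d)} {r : ℕ}

open Classical in
theorem Regular.card_not_populated_le (h : Regular ω M θ m₀ ℓ k₀) (a : Fin d → ZMod M) :
    ((Grid.box d (localRadius d k₀)).filter (· ∉ populated ω m₀ ℓ a)).card ≤ k₀ :=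
  (Finset.card_le_card (Finset.filter_subset_filter _ (Grid.box_mono (Nat.le_succ _)))).trans
    (h.sparse a)

theorem Regular.exists_isCrossing (h : Regular ω M θ m₀ ℓ k₀) (a : Fin d → ZMod M) :
    ∃ t, IsCrossing ω m₀ ℓ k₀ a t := by
  choose t ht hslab using Grid.exists_slab_subset (h.card_not_populated_le a)
  exact ⟨t, ht, hslab⟩

theorem lt_localRadius (d k₀ : ℕ) : k₀ < localRadius d k₀ := by
  rw [localRadius]
  omega

theorem IsCrossing.mem_box (ht : IsCrossing ω m₀ ℓ k₀ a t) : t ∈ Grid.box d (localRadius d k₀) :=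
  Grid.mem_box.2 fun k => by
    have := ht.mem_Icc k
    have := lt_localRadius d k₀
    omega

theorem IsCrossing.mem_populated (ht : IsCrossing ω m₀ ℓ k₀ a t) (hd : 2 ≤ d) :
    t ∈ populated ω m₀ ℓ a :=
  ht.slab ⟨0, by omega⟩ t ht.mem_box rfl

theorem IsCrossing.core_subset (ht : IsCrossing ω m₀ ℓ k₀ a t) (hd : 2 ≤ d) :
    core ω m₀ ℓ k₀ a t ⊆ populated ω m₀ ℓ a ∩ Grid.box d (localRadius d k₀) :=
  fun _ hv => mem_of_reachable_within ⟨ht.mem_populated hd, ht.mem_box⟩ hv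

open Classical in
theorem Regular.card_not_core_le (h : Regular ω M θ m₀ ℓ k₀) (ht : IsCrossing ω m₀ ℓ k₀ a t) :
    ((Grid.box d (localRadius d k₀)).filter (· ∉ core ω m₀ ℓ k₀ a t)).card ≤ k₀ ^ 2 :=
  Grid.card_not_reachable_le h.two_le_dim (h.card_not_populated_le a) ht.mem_box ht.slab

theorem cluster_subset_backbone : (cluster ω m₀ (a + red M t) : Set (Fin n)) ⊆
    backbone ω m₀ ℓ k₀ a t :=
  fun _ hb => ⟨t, SimpleGraph.Reachable.rfl, hb⟩

theorem Regular.exists_mem_backbone_toricDist_le (h : Regular ω M θ m₀ ℓ k₀)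
    (ht : IsCrossing ω m₀ ℓ k₀ a t) (hr : r + 1 + k₀ ^ 2 ≤ localRadius d k₀)
    (hq : ‖q - pt a‖ ≤ r * mesh M) :
    ∃ b ∈ backbone ω m₀ ℓ k₀ a t, toricDist q (ω b).1 ≤ hopRadius d k₀ * mesh M / 2 := by
  have : NeZero d := ⟨by have := h.two_le_dim; omega⟩
  obtain ⟨v, hv, hvq⟩ := exists_mem_box_norm_sub_pt_le a hq
  obtain ⟨w, hw, hcore⟩ := Grid.exists_add_mem_of_card_le (h.card_not_core_le ht) hv hr
  obtain ⟨b, hb⟩ := cluster_nonempty h.one_le (ht.core_subset h.two_le_dim hcore).1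
  refine ⟨b, ⟨v + w, hcore, hb⟩, ?_⟩
  have hdist : ‖q - pt (a + red M (v + w))‖ ≤ (k₀ ^ 2 + 1 : ℝ) * mesh M := by
    have hvw := norm_pt_add_red_sub_le (a + red M v) hw
    have htri := norm_sub_le_norm_sub_add_norm_sub q (pt (a + red M v)) (pt (a + red M v + red M w))
    rw [norm_sub_rev (pt (a + red M v))] at htri
    rw [red_add, ← add_assoc]
    push_cast at hvw
    linarith
  calc toricDist q (ω b).1 ≤ d * ((k₀ ^ 2 + 1 + 1 / 3) * mesh M) :=
        toricDist_le_of_mem_cluster hb hdist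
    _ ≤ d * ((k₀ ^ 2 + 2) * mesh M) := by
        have := mesh_pos (M := M)
        gcongr ?_ * (?_ * _)
        linarith
    _ = hopRadius d k₀ * mesh M / 2 := by
        rw [hopRadius]
        push_cast
        ring

theorem Regular.reachable_of_mem_attached (h : Regular ω M θ m₀ ℓ k₀)
    (ht : IsCrossing ω m₀ ℓ k₀ a t) (hx : x ∈ attached ω θ m₀ ℓ k₀ a t) {b : Fin n}
    (hb : b ∈ cluster ω m₀ (a + red M t)) :
    (within (graph θ ω) (insert x (near ω a (localRadius d k₀ + 1)))).Reachable x b := by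
  obtain ⟨b', ⟨v, hv, hb'⟩, hxb'⟩ := hx
  have hnear := cluster_subset_near (ht.core_subset h.two_le_dim hv).2 hb'
  exact (reachable_within_of_eq_or_adj (Set.mem_insert _ _) (Set.mem_insert_of_mem _ hnear)
    hxb').trans ((h.reachable_of_mem_cluster ht.mem_box hv hb hb').symm.mono
      (within_mono (Set.subset_insert _ _)))

theorem Regular.weight_lt_of_notMem_attached (h : Regular ω M θ m₀ ℓ k₀)
    (ht : IsCrossing ω m₀ ℓ k₀ a t) (hx : x ∉ attached ω θ m₀ ℓ k₀ a t)
    (hxa : ‖(ω x).1 - pt a‖ ≤ trapRadius d k₀ * mesh M) :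
    (ω x).2 < θ * (hopRadius d k₀ * mesh M / 2) ^ d := by
  obtain ⟨b, hb, hdist⟩ := h.exists_mem_backbone_toricDist_le ht (by rw [localRadius]; omega) hxa
  by_contra! hcon
  refine hx ⟨b, hb, or_iff_not_imp_left.2 fun hne => ⟨hne, ?_⟩⟩
  have := h.theta_pos
  have := toricDist_nonneg (ω x).1 (ω b).1
  calc θ * toricDist (ω x).1 (ω b).1 ^ d ≤ θ * (hopRadius d k₀ * mesh M / 2) ^ d := by gcongr
    _ ≤ (ω x).2 := hcon
    _ ≤ (ω x).2 + (ω b).2 := le_add_of_nonneg_right (h.weight_nonneg b)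

-- A long edge from `x` to `y` passes a backbone node `b` close to the geodesic. As `x` is light,
-- `y` must be heavy enough to reach the end of the edge, hence to reach `b`.
theorem Regular.mem_attached_of_adj_of_lt_toricDist (h : Regular ω M θ m₀ ℓ k₀)
    (ht : IsCrossing ω m₀ ℓ k₀ a t) (hxa : ‖(ω x).1 - pt a‖ ≤ trapRadius d k₀ * mesh M)
    (hx : (ω x).2 < θ * (hopRadius d k₀ * mesh M / 2) ^ d) (hadj : (graph θ ω).Adj x y)
    (hlong : hopRadius d k₀ * mesh M < toricDist (ω x).1 (ω y).1) :
    y ∈ attached ω θ m₀ ℓ k₀ a t := by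
  set R := hopRadius d k₀ * mesh M with hR
  set D := toricDist (ω x).1 (ω y).1 with hD
  have hd := h.two_le_dim
  have hθ := h.theta_pos
  have hR0 : 0 ≤ R := mul_nonneg (Nat.cast_nonneg _) mesh_pos.le
  have hD0 : 0 < D := hR0.trans_lt hlong
  obtain ⟨q, hxq, hqy⟩ := exists_toricDist_le_mul_and_le_one_sub_mul (ω x).1 (ω y).1
    (l := R / D) (by positivity) ((div_le_one hD0).2 hlong.le)
  rw [← hD, div_mul_cancel₀ _ hD0.ne'] at hxq
  rw [← hD, one_sub_mul, div_mul_cancel₀ _ hD0.ne'] at hqy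
  have hqa : ‖q - pt a‖ ≤ (trapRadius d k₀ + hopRadius d k₀ : ℕ) * mesh M := by
    have htri := norm_sub_le_norm_sub_add_norm_sub q (ω x).1 (pt a)
    rw [norm_sub_rev q (ω x).1] at htri
    rw [Nat.cast_add, add_mul, ← hR]
    linarith [norm_sub_le_toricDist (ω x).1 q]
  obtain ⟨b, hb, hqb⟩ := h.exists_mem_backbone_toricDist_le ht (by rw [localRadius]; omega) hqa
  refine ⟨b, hb, or_iff_not_imp_left.2 fun hne => ⟨hne, ?_⟩⟩
  have hyb : toricDist (ω y).1 (ω b).1 ≤ D - R / 2 := by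
    have htri := toricDist_triangle (ω y).1 q (ω b).1
    rw [toricDist_comm _ q] at htri
    linarith
  have hpow : toricDist (ω y).1 (ω b).1 ^ d ≤ D ^ d - (R / 2) ^ d := by
    have hadd := pow_add_pow_le (by linarith : 0 ≤ D - R / 2) (by linarith : 0 ≤ R / 2)
      (by omega : d ≠ 0)
    rw [sub_add_cancel] at hadd
    linarith [pow_le_pow_left₀ (toricDist_nonneg _ _) hyb d]
  calc θ * toricDist (ω y).1 (ω b).1 ^ d ≤ θ * D ^ d - θ * (R / 2) ^ d := by
        rw [← mul_sub]
        gcongr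
    _ ≤ (ω y).2 := by linarith [hadj.2]
    _ ≤ (ω y).2 + (ω b).2 := le_add_of_nonneg_right (h.weight_nonneg b)

theorem Regular.norm_sub_le_of_notMem_attached (h : Regular ω M θ m₀ ℓ k₀)
    (ht : IsCrossing ω m₀ ℓ k₀ a t) (hx : x ∉ attached ω θ m₀ ℓ k₀ a t)
    (hxa : ‖(ω x).1 - pt a‖ ≤ trapRadius d k₀ * mesh M) (hadj : (graph θ ω).Adj x y)
    (hy : y ∉ attached ω θ m₀ ℓ k₀ a t) : ‖(ω y).1 - (ω x).1‖ ≤ hopRadius d k₀ * mesh M := by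
  rw [norm_sub_rev]
  refine (norm_sub_le_toricDist _ _).trans (not_lt.1 fun hlong => hy ?_)
  exact h.mem_attached_of_adj_of_lt_toricDist ht hxa (h.weight_lt_of_notMem_attached ht hx hxa) hadj
    hlong

theorem Regular.exists_notMem_core_of_notMem_attached (h : Regular ω M θ m₀ ℓ k₀)
    (ht : IsCrossing ω m₀ ℓ k₀ a t) (hx : x ∉ attached ω θ m₀ ℓ k₀ a t)
    (hr : r + 1 ≤ localRadius d k₀) (hxa : ‖(ω x).1 - pt a‖ ≤ r * mesh M) :
    ∃ v ∈ Grid.box d (localRadius d k₀), v ∉ core ω m₀ ℓ k₀ a t ∧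
      ‖(ω x).1 - pt (a + red M v)‖ ≤ mesh M := by
  obtain ⟨v, hv, hxv⟩ := exists_mem_box_norm_sub_pt_le a hxa
  refine ⟨v, Grid.box_mono hr hv, fun hcore => hx ?_, hxv⟩
  obtain ⟨b, hb⟩ := cluster_nonempty h.one_le (ht.core_subset h.two_le_dim hcore).1
  exact ⟨b, ⟨v, hcore, hb⟩, h.eq_or_adj_of_norm_sub_le hb (by linarith [mesh_pos (M := M)])⟩

open Classical in
theorem Regular.exists_annulus_subset_attached (h : Regular ω M θ m₀ ℓ k₀)
    (ht : IsCrossing ω m₀ ℓ k₀ a t) :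
    ∃ r : ℕ, 1 ≤ r ∧ r + hopRadius d k₀ ≤ trapRadius d k₀ ∧
      ∀ x : Fin n, r * mesh M < ‖(ω x).1 - pt a‖ →
        ‖(ω x).1 - pt a‖ ≤ (r + hopRadius d k₀ : ℕ) * mesh M → x ∈ attached ω θ m₀ ℓ k₀ a t := by
  set R := hopRadius d k₀ with hR
  set B := (Grid.box d (localRadius d k₀)).filter (· ∉ core ω m₀ ℓ k₀ a t)
  let layer : (Fin d → ℤ) → ℕ := fun v => ⌊‖pt (a + red M v) - pt a‖ / ((R + 3 : ℕ) * mesh M)⌋₊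
  have hcard : (B.image layer).card < (Finset.range (k₀ ^ 2 + 1)).card := by
    rw [Finset.card_range, Nat.lt_succ_iff]
    exact Finset.card_image_le.trans (h.card_not_core_le ht)
  obtain ⟨j, hj, hjB⟩ := Finset.exists_mem_notMem_of_card_lt_card hcard
  have htrap : j * (R + 3) + 1 + R + 2 ≤ trapRadius d k₀ := by
    have hmul := Nat.mul_le_mul_right (R + 3) (Finset.mem_range.1 hj)
    rw [trapRadius, ← hR]
    linarith
  refine ⟨j * (R + 3) + 1, by omega, by omega, fun x hlow hup => ?_⟩
  by_contra hx
  obtain ⟨v, hv, hcore, hxv⟩ := h.exists_notMem_core_of_notMem_attached ht hx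
    (by rw [localRadius]; omega) hup
  refine hjB (Finset.mem_image.2 ⟨v, Finset.mem_filter.2 ⟨hv, hcore⟩, ?_⟩)
  have hs := mesh_pos (M := M)
  have hle := norm_sub_le_norm_sub_add_norm_sub (ω x).1 (pt (a + red M v)) (pt a)
  have hge := norm_sub_le_norm_sub_add_norm_sub (pt (a + red M v)) (ω x).1 (pt a)
  rw [norm_sub_rev _ (ω x).1] at hge
  push_cast at hlow hup
  rw [Nat.floor_eq_iff (by positivity), le_div_iff₀ (by positivity), div_lt_iff₀ (by positivity)]
  push_cast
  constructor <;> linarith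

theorem Regular.exists_reachable (h : Regular ω M θ m₀ ℓ k₀) (hG : (graph θ ω).Connected)
    (ht : IsCrossing ω m₀ ℓ k₀ a t) (hy : ‖(ω y).1 - pt a‖ ≤ mesh M) :
    ∃ u, ∀ b ∈ cluster ω m₀ (a + red M t),
      (within (graph θ ω) (insert u (near ω a (localRadius d k₀ + 1)))).Reachable y b := by
  by_cases hya : y ∈ attached ω θ m₀ ℓ k₀ a t
  · exact ⟨y, fun b hb => h.reachable_of_mem_attached ht hya hb⟩
  obtain ⟨r, hr1, hrtrap, hannulus⟩ := h.exists_annulus_subset_attached ht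
  set S : Set (Fin n) := {x | x ∈ near ω a r ∧ x ∉ attached ω θ m₀ ℓ k₀ a t}
  have hyS : y ∈ S := by
    refine ⟨near_mono hr1 (mem_near.2 ?_), hya⟩
    rwa [Nat.cast_one, one_mul]
  obtain ⟨b₀, hb₀⟩ := cluster_nonempty h.one_le (ht.mem_populated h.two_le_dim)
  obtain ⟨z, hz, u, hu, hzu, hyz⟩ := exists_adj_notMem_and_reachable_within
    (hG.preconnected y b₀) hyS fun hb => hb.2 ⟨b₀, cluster_subset_backbone hb₀, Or.inl rfl⟩
  have hua : u ∈ attached ω θ m₀ ℓ k₀ a t := by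
    by_contra hua
    have hzr := mem_near.1 hz.1
    have hhop := h.norm_sub_le_of_notMem_attached ht hz.2
      (mem_near.1 (near_mono (by omega) hz.1)) hzu hua
    refine hua (hannulus u (not_le.1 fun hle => hu ⟨mem_near.2 hle, hua⟩) ?_)
    rw [Nat.cast_add, add_mul]
    linarith [norm_sub_le_norm_sub_add_norm_sub (ω u).1 (ω z).1 (pt a)]
  have hSnear : S ⊆ insert u (near ω a (localRadius d k₀ + 1)) := fun x hx =>
    Set.mem_insert_of_mem _ (near_mono (by rw [localRadius]; omega) hx.1)
  exact ⟨u, fun b hb => ((hyz.mono (within_mono hSnear)).trans (reachable_within_of_eq_or_adj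
    (hSnear hz) (Set.mem_insert _ _) (Or.inr hzu))).trans (h.reachable_of_mem_attached ht hua hb)⟩

end Crossing

end GTG

/-! ### Poincaré inequalities on regular configurations -/

open scoped BigOperators

section Mean

variable {ι : Type*} {s t : Finset ι}

theorem expect_sub_sq_eq (hs : s.Nonempty) (f : ι → ℝ) (c : ℝ) :
    𝔼 x ∈ s, (f x - c) ^ 2
      = (𝔼 x ∈ s, f x - c) ^ 2 + (𝔼 x ∈ s, 𝔼 y ∈ s, (f x - f y) ^ 2) / 2 := by
  simp only [sub_sq, Finset.expect_add_distrib, Finset.expect_sub_distrib, Finset.expect_const hs,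
    ← Finset.mul_expect, ← Finset.expect_mul]
  ring

theorem sq_expect_sub_le (hs : s.Nonempty) (f : ι → ℝ) (c : ℝ) :
    (𝔼 x ∈ s, f x - c) ^ 2 ≤ 𝔼 x ∈ s, (f x - c) ^ 2 := by
  rw [expect_sub_sq_eq hs]
  have : 0 ≤ 𝔼 x ∈ s, 𝔼 y ∈ s, (f x - f y) ^ 2 :=
    Finset.expect_nonneg fun _ _ => Finset.expect_nonneg fun _ _ => sq_nonneg _
  linarith

theorem sq_expect_sub_expect_le (hs : s.Nonempty) (ht : t.Nonempty) (f : ι → ℝ) :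
    (𝔼 x ∈ s, f x - 𝔼 y ∈ t, f y) ^ 2 ≤ 𝔼 x ∈ s, 𝔼 y ∈ t, (f x - f y) ^ 2 :=
  (sq_expect_sub_le hs f _).trans <| Finset.expect_le_expect fun x _ => by
    simpa only [sub_sq_comm (f x)] using sq_expect_sub_le ht f (f x)

open Classical in
theorem card_mul_sum_sq_le (hs : 4 ≤ s.card) (f : ι → ℝ) :
    s.card * ∑ x ∈ s, f x ^ 2
      ≤ ∑ x ∈ s, ∑ y ∈ s, if x = y then 0 else (f x + f y) ^ 2 := by
  have hdiag : ∀ x ∈ s, ∑ y ∈ s, (if x = y then 0 else (f x + f y) ^ 2)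
      = ∑ y ∈ s, (f x + f y) ^ 2 - 4 * f x ^ 2 := fun x hx => by
    rw [eq_sub_iff_add_eq, ← Finset.sum_erase_add s _ hx, ← Finset.sum_erase_add s _ hx, if_pos rfl,
      Finset.sum_congr rfl fun y hy => if_neg (Finset.ne_of_mem_erase hy).symm]
    ring
  have hsum : ∑ x ∈ s, ∑ y ∈ s, (f x + f y) ^ 2
      = 2 * s.card * ∑ x ∈ s, f x ^ 2 + 2 * (∑ x ∈ s, f x) ^ 2 := by
    simp only [add_sq, Finset.sum_add_distrib, Finset.sum_const, nsmul_eq_mul, ← Finset.mul_sum,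
      ← Finset.sum_mul]
    ring
  rw [Finset.sum_congr rfl hdiag, Finset.sum_sub_distrib, hsum, ← Finset.mul_sum]
  have hcard : (4 : ℝ) * ∑ x ∈ s, f x ^ 2 ≤ s.card * ∑ x ∈ s, f x ^ 2 :=
    mul_le_mul_of_nonneg_right (by exact_mod_cast hs) (Finset.sum_nonneg fun _ _ => sq_nonneg _)
  linarith [sq_nonneg (∑ x ∈ s, f x)]

theorem sum_sub_expect_sq_le_of_torus {d M : ℕ} [NeZero M] (g : (Fin d → ZMod M) → ℝ) :
    ∑ a, (g a - 𝔼 b, g b) ^ 2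
      ≤ (d : ℝ) * M ^ 2 * ∑ a, ∑ j, (g (a + Pi.single j 1) - g a) ^ 2 := by
  have hcard : ((Finset.univ : Finset (Fin d → ZMod M)).card : ℝ) = M ^ d := by simp
  have hM : (0 : ℝ) < M ^ d := pow_pos (Nat.cast_pos.2 (NeZero.pos M)) d
  have hvar := expect_sub_sq_eq Finset.univ_nonempty g (𝔼 b, g b)
  set c := 𝔼 b, g b
  simp only [Fintype.expect_eq_sum_div_card, sub_self] at hvar
  simp only [← Finset.card_univ, hcard, ← Finset.sum_div] at hvar
  have htorus := sum_sum_sq_sub_le_of_torus g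
  have hnonneg : 0 ≤ ∑ a, (g a - c) ^ 2 := Finset.sum_nonneg fun _ _ => sq_nonneg _
  rw [Finset.sum_comm] at htorus
  field_simp at hvar
  refine le_of_mul_le_mul_left ?_ hM
  linarith [mul_nonneg hM.le hnonneg]

end Mean

section Degree

variable {V : Type*} [Fintype V] (G : SimpleGraph V)

open Classical in
theorem sum_sum_le_dartSum {s s' t : Finset V} {F : V → V → ℝ} (hF : ∀ x y, 0 ≤ F x y)
    (hs : s ⊆ s') (hadj : ∀ x ∈ s, ∀ y ∈ t, x = y ∨ G.Adj x y) :
    ∑ x ∈ s, ∑ y ∈ t, (if x = y then 0 else F x y) ≤ dartSum G s' Finset.univ F := by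
  refine le_trans (Finset.sum_le_sum fun x hx => Finset.sum_le_sum fun y hy => ?_)
    (dartSum_mono hF le_rfl hs (Finset.subset_univ t))
  split_ifs with hxy hG hG
  exacts [hF x y, le_rfl, le_rfl, absurd ((hadj x hx y hy).resolve_left hxy) hG]

open Classical in
-- Each edge is charged to its endpoint of smaller weight `w`.
theorem sum_degree_mul_sq_le {α : Type*} [LinearOrder α] (w : V → α) {N : ℝ}
    (hN : ∀ x, ((Finset.univ.filter fun y => G.Adj x y ∧ w x ≤ w y).card : ℝ) ≤ N) (f : V → ℝ) :
    ∑ x, (G.degree x : ℝ) * f x ^ 2 ≤ energy G f + 3 * N * ∑ x, f x ^ 2 := by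
  set J : V → V → ℝ := fun x y => if w x ≤ w y then f x ^ 2 else 0 with hJ
  have hfst := sum_degree_mul_eq_dartSum G fun x => f x ^ 2
  have hsnd := hfst.trans (dartSum_comm _ _ _ _)
  have hcharge : dartSum G Finset.univ Finset.univ J ≤ N * ∑ x, f x ^ 2 := by
    rw [Finset.mul_sum]
    refine Finset.sum_le_sum fun x _ => ?_
    rw [← Finset.sum_filter, ← Finset.sum_filter, Finset.filter_filter, Finset.sum_const,
      nsmul_eq_mul]
    exact mul_le_mul_of_nonneg_right (hN x) (sq_nonneg _)
  have hpointwise : ∀ x y, f x ^ 2 + f y ^ 2 ≤ 2 * (f x - f y) ^ 2 + 3 * (J x y + J y x) := by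
    intro x y
    rcases le_total (w x) (w y) with h | h <;> simp only [hJ, h, if_true] <;> split_ifs <;>
      nlinarith [sq_nonneg (f x), sq_nonneg (f y), sq_nonneg (2 * f x - f y),
        sq_nonneg (2 * f y - f x)]
  have hsum := dartSum_le_dartSum (G := G) (s := Finset.univ) (t := Finset.univ) hpointwise
  have hcomm := dartSum_comm G Finset.univ Finset.univ J
  simp only [dartSum_add, dartSum_const_mul] at hsum
  rw [energy]
  linarith

open Classical in
theorem sum_degree_mul_sq_le_sum_degree_mul_sub_sq {f : V → ℝ}
    (hf : ∑ x, (G.degree x : ℝ) * f x = 0) (c : ℝ) :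
    ∑ x, (G.degree x : ℝ) * f x ^ 2 ≤ ∑ x, (G.degree x : ℝ) * (f x - c) ^ 2 := by
  have hexpand : ∑ x, (G.degree x : ℝ) * (f x - c) ^ 2
      = ∑ x, (G.degree x : ℝ) * f x ^ 2 - 2 * c * ∑ x, (G.degree x : ℝ) * f x
        + ∑ x, (G.degree x : ℝ) * c ^ 2 := by
    rw [Finset.mul_sum, ← Finset.sum_sub_distrib, ← Finset.sum_add_distrib]
    exact Finset.sum_congr rfl fun x _ => by ring
  have hconst : 0 ≤ ∑ x, (G.degree x : ℝ) * c ^ 2 := Finset.sum_nonneg fun _ _ => by positivity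
  rw [hexpand, hf]
  linarith

theorem energy_sub_const (f : V → ℝ) (c : ℝ) : energy G (fun x => f x - c) = energy G f := by
  simp only [energy, sub_sub_sub_cancel_right]

end Degree

namespace GTG

variable {d n M : ℕ} [NeZero M] {ω : Config d n} {θ m₀ ℓ N : ℝ} {k₀ : ℕ}

/-- The sum of `F x y` over the oriented edges `xy` that start near the lattice point of index
`a`. -/
noncomputable def localSum (ω : Config d n) (θ : ℝ) (k₀ : ℕ) (a : Fin d → ZMod M)
    (F : Fin n → Fin n → ℝ) : ℝ :=
  dartSum (graph θ ω) (near ω a (localRadius d k₀ + 2)) Finset.univ F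

/-- The number of local neighbourhoods that a node can belong to, up to a bound. -/
noncomputable def overlap (d k₀ : ℕ) : ℕ :=
  (Grid.box d (2 * (localRadius d k₀ + 2) : ℕ)).card

open Classical in
/-- No local neighbourhood contains more than `N` nodes, and no node has more than `N` neighbours of
larger weight. -/
structure Uncrowded (ω : Config d n) (M : ℕ) [NeZero M] (θ N : ℝ) (k₀ : ℕ) : Prop where
  one_le : 1 ≤ N
  card_near_le : ∀ a : Fin d → ZMod M, ((near ω a (localRadius d k₀ + 2)).card : ℝ) ≤ N
  card_heavier_le : ∀ x,
    ((Finset.univ.filter fun y => (graph θ ω).Adj x y ∧ (ω x).2 ≤ (ω y).2).card : ℝ) ≤ N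

section LocalSum

variable {a : Fin d → ZMod M} {t u v : Fin d → ℤ} {F : Fin n → Fin n → ℝ}

theorem localSum_nonneg (a : Fin d → ZMod M) (hF : ∀ x y, 0 ≤ F x y) : 0 ≤ localSum ω θ k₀ a F :=
  dartSum_nonneg hF

theorem sum_localSum_le (hF : ∀ x y, 0 ≤ F x y) :
    ∑ a : Fin d → ZMod M, localSum ω θ k₀ a F
      ≤ overlap d k₀ * dartSum (graph θ ω) Finset.univ Finset.univ F := by
  classical
  simp only [localSum, dartSum, near, Finset.sum_filter]
  rw [Finset.sum_comm, Finset.mul_sum]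
  refine Finset.sum_le_sum fun x _ => ?_
  rw [← Finset.sum_filter, Finset.sum_const, nsmul_eq_mul]
  refine mul_le_mul_of_nonneg_right (Nat.cast_le.2 (card_filter_norm_sub_pt_le _ _)) ?_
  exact Finset.sum_nonneg fun y _ => by split_ifs; exacts [hF x y, le_rfl]

theorem cluster_subset_near_localRadius (hv : v ∈ Grid.box d (localRadius d k₀ + 1)) :
    cluster ω m₀ (a + red M v) ⊆ near ω a (localRadius d k₀ + 2) :=
  cluster_subset_near hv

theorem Regular.sq_sub_le (h : Regular ω M θ m₀ ℓ k₀) (hU : Uncrowded ω M θ N k₀)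
    (hG : (graph θ ω).Connected) (ht : IsCrossing ω m₀ ℓ k₀ a t) (f : Fin n → ℝ) {y b : Fin n}
    (hy : ‖(ω y).1 - pt a‖ ≤ mesh M) (hb : b ∈ cluster ω m₀ (a + red M t)) :
    (f y - f b) ^ 2 ≤ 4 * N * localSum ω θ k₀ a fun x y => (f x - f y) ^ 2 := by
  obtain ⟨u, hu⟩ := h.exists_reachable hG ht hy
  have hnear := near_mono (ω := ω) (a := a) (localRadius d k₀ + 1).le_succ
  have hcard : ((near ω a (localRadius d k₀ + 1)).card : ℝ) ≤ N :=
    (Nat.cast_le.2 (Finset.card_le_card hnear)).trans (hU.card_near_le a)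
  have h1 := hU.one_le
  calc (f y - f b) ^ 2 ≤ _ := sq_sub_le_of_reachable_within_insert f (hu b hb)
    _ ≤ (N + N) * (2 * localSum ω θ k₀ a fun x y => (f x - f y) ^ 2) := by
        gcongr
        · exact mul_nonneg two_pos.le (dartSum_nonneg fun _ _ => sq_nonneg _)
        · exact dartSum_mono (fun _ _ => sq_nonneg _) le_rfl hnear subset_rfl
    _ = _ := by ring

theorem Regular.sq_le (h : Regular ω M θ m₀ ℓ k₀) (hU : Uncrowded ω M θ N k₀)
    (hG : (graph θ ω).Connected) (ht : IsCrossing ω m₀ ℓ k₀ a t) (f : Fin n → ℝ) {y : Fin n}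
    (hy : ‖(ω y).1 - pt a‖ ≤ mesh M) :
    f y ^ 2 ≤ 2 * 𝔼 b ∈ cluster ω m₀ (a + red M t), f b ^ 2
      + 8 * N * localSum ω θ k₀ a fun x y => (f x - f y) ^ 2 := by
  have hne := cluster_nonempty h.one_le (ht.mem_populated h.two_le_dim)
  rw [Finset.mul_expect, ← Finset.expect_const hne (8 * N * _), ← Finset.expect_add_distrib]
  refine Finset.le_expect hne fun b hb => ?_
  linarith [h.sq_sub_le hU hG ht f hy hb, sq_nonneg (f y - 2 * f b)]

theorem Uncrowded.sum_le (hU : Uncrowded ω M θ N k₀) {φ : Fin n → ℝ} {Φ : (Fin d → ZMod M) → ℝ}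
    (hΦ : ∀ a, 0 ≤ Φ a) (h : ∀ a y, ‖(ω y).1 - pt a‖ ≤ mesh M → φ y ≤ Φ a) :
    ∑ y, φ y ≤ N * ∑ a, Φ a := by
  classical
  choose c hc using fun y => exists_norm_sub_pt_le (M := M) (ω y).1
  rw [← Finset.sum_fiberwise Finset.univ c, Finset.mul_sum]
  refine Finset.sum_le_sum fun a _ => ?_
  have hsub : Finset.univ.filter (fun y => c y = a) ⊆ near ω a (localRadius d k₀ + 2) := by
    rintro y hy
    rw [← (Finset.mem_filter.1 hy).2]
    refine near_mono (Nat.le_add_left 1 _) (mem_near.2 ?_)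
    rw [Nat.cast_one, one_mul]
    exact hc y
  calc ∑ y with c y = a, φ y ≤ (Finset.univ.filter fun y => c y = a).card • Φ a :=
        Finset.sum_le_card_nsmul _ _ _ fun y hy => h a y ((Finset.mem_filter.1 hy).2 ▸ hc y)
    _ ≤ N * Φ a := by
        rw [nsmul_eq_mul]
        exact mul_le_mul_of_nonneg_right
          ((Nat.cast_le.2 (Finset.card_le_card hsub)).trans (hU.card_near_le a)) (hΦ a)

open Classical in
theorem Regular.sum_degree_mul_sq_le (h : Regular ω M θ m₀ ℓ k₀) (hU : Uncrowded ω M θ N k₀)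
    (hG : (graph θ ω).Connected) {t : (Fin d → ZMod M) → Fin d → ℤ}
    (ht : ∀ a, IsCrossing ω m₀ ℓ k₀ a (t a)) (f : Fin n → ℝ) :
    ∑ x, ((graph θ ω).degree x : ℝ) * f x ^ 2
      ≤ (1 + 24 * N ^ 3 * overlap d k₀) * energy (graph θ ω) f
        + 6 * N ^ 2 * ∑ a, 𝔼 b ∈ cluster ω m₀ (a + red M (t a)), f b ^ 2 := by
  set E : (Fin d → ZMod M) → ℝ := fun a => localSum ω θ k₀ a fun x y => (f x - f y) ^ 2
  set A : (Fin d → ZMod M) → ℝ := fun a => 𝔼 b ∈ cluster ω m₀ (a + red M (t a)), f b ^ 2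
  have hN := hU.one_le
  have hE : ∀ a, 0 ≤ E a := fun a => localSum_nonneg a fun _ _ => sq_nonneg _
  have hA : ∀ a, 0 ≤ A a := fun a => Finset.expect_nonneg fun _ _ => sq_nonneg _
  have hsum : ∑ y, f y ^ 2 ≤ N * ∑ a, (2 * A a + 8 * N * E a) :=
    hU.sum_le (fun a => by have := hE a; have := hA a; positivity)
      fun a y hy => h.sq_le hU hG (ht a) f hy
  rw [Finset.sum_add_distrib, ← Finset.mul_sum, ← Finset.mul_sum] at hsum
  calc ∑ x, ((graph θ ω).degree x : ℝ) * f x ^ 2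
      ≤ energy (graph θ ω) f + 3 * N * ∑ y, f y ^ 2 :=
        _root_.sum_degree_mul_sq_le _ (fun x => (ω x).2) hU.card_heavier_le f
    _ ≤ energy (graph θ ω) f + 3 * N * (N * (2 * ∑ a, A a
          + 8 * N * (overlap d k₀ * energy (graph θ ω) f))) := by
        gcongr
        refine hsum.trans ?_
        gcongr
        exact sum_localSum_le fun _ _ => sq_nonneg _
    _ = _ := by ring

theorem Regular.expect_sq_le_signless (h : Regular ω M θ m₀ ℓ k₀) (hℓ : 4 ≤ ℓ)
    (hv : v ∈ Grid.box d (localRadius d k₀ + 1)) (hpop : v ∈ populated ω m₀ ℓ a) (f : Fin n → ℝ) :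
    𝔼 b ∈ cluster ω m₀ (a + red M v), f b ^ 2
      ≤ localSum ω θ k₀ a (fun x y => (f x + f y) ^ 2) / ℓ ^ 2 := by
  set B := cluster ω m₀ (a + red M v)
  have hB : ℓ ≤ B.card := hpop
  have hcard : 4 ≤ B.card := by exact_mod_cast hℓ.trans hB
  have hsum : B.card * ∑ b ∈ B, f b ^ 2 ≤ localSum ω θ k₀ a fun x y => (f x + f y) ^ 2 :=
    (card_mul_sum_sq_le hcard f).trans <| sum_sum_le_dartSum _ (fun _ _ => sq_nonneg _)
      (cluster_subset_near_localRadius hv) fun b hb b' hb' =>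
        h.eq_or_adj_of_mem_cluster hb hb' (by simpa using mesh_pos.le)
  have hB0 : (0 : ℝ) < B.card := by linarith
  calc 𝔼 b ∈ B, f b ^ 2 = B.card * (∑ b ∈ B, f b ^ 2) / B.card ^ 2 := by
        rw [Finset.expect_eq_sum_div_card]
        field_simp
    _ ≤ _ := by
        gcongr
        exact localSum_nonneg a fun _ _ => sq_nonneg _

theorem Regular.expect_expect_sq_sub_le (h : Regular ω M θ m₀ ℓ k₀)
    (hu : u ∈ Grid.box d (localRadius d k₀ + 1)) (hpopu : u ∈ populated ω m₀ ℓ a)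
    (hpopv : v ∈ populated ω m₀ ℓ a)
    (huv : ‖pt (a + red M u) - pt (a + red M v)‖ ≤ mesh M) (f : Fin n → ℝ) :
    𝔼 b ∈ cluster ω m₀ (a + red M u), 𝔼 b' ∈ cluster ω m₀ (a + red M v), (f b - f b') ^ 2
      ≤ localSum ω θ k₀ a (fun x y => (f x - f y) ^ 2) / ℓ ^ 2 := by
  classical
  set B := cluster ω m₀ (a + red M u)
  set B' := cluster ω m₀ (a + red M v)
  have hℓ := h.one_le
  have hB : ℓ ≤ B.card := hpopu
  have hB' : ℓ ≤ B'.card := hpopv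
  have hsum : ∑ b ∈ B, ∑ b' ∈ B', (f b - f b') ^ 2
      ≤ localSum ω θ k₀ a fun x y => (f x - f y) ^ 2 := by
    refine le_trans (Finset.sum_le_sum fun b _ => Finset.sum_le_sum fun b' _ => ?_)
      (sum_sum_le_dartSum (graph θ ω) (fun _ _ => sq_nonneg _) (cluster_subset_near_localRadius hu)
        fun b hb b' hb' => h.eq_or_adj_of_mem_cluster hb hb' huv)
    split_ifs with hbb
    · simp [hbb]
    · rfl
  simp only [Finset.expect_eq_sum_div_card, ← Finset.sum_div, div_div]
  gcongr
  · exact localSum_nonneg a fun _ _ => sq_nonneg _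
  · rw [sq]
    gcongr

end LocalSum

/-- The constant in the Poincaré inequalities for regular uncrowded configurations. -/
noncomputable def poincareConst (d k₀ M : ℕ) (N ℓ : ℝ) : ℝ :=
  1 + 24 * N ^ 3 * overlap d k₀ + 6 * (N / ℓ) ^ 2 *
    (overlap d k₀ * (d ^ 2 * M ^ 2 * (Grid.box d (localRadius d k₀ + 1)).card ^ 3 + 1))

section Poincare

variable {f : Fin n → ℝ} {t : (Fin d → ZMod M) → Fin d → ℤ}

theorem IsCrossing.mem_box_succ {a : Fin d → ZMod M} {t : Fin d → ℤ}
    (ht : IsCrossing ω m₀ ℓ k₀ a t) : t ∈ Grid.box d (localRadius d k₀ + 1) :=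
  Grid.box_mono (Nat.le_succ _) ht.mem_box

open Classical in
theorem Regular.signless_poincare (h : Regular ω M θ m₀ ℓ k₀) (hU : Uncrowded ω M θ N k₀)
    (hG : (graph θ ω).Connected) (hℓ : 4 ≤ ℓ) (f : Fin n → ℝ) :
    ∑ x, ((graph θ ω).degree x : ℝ) * f x ^ 2
      ≤ poincareConst d k₀ M N ℓ * signlessEnergy (graph θ ω) f := by
  choose t ht using fun a : Fin d → ZMod M => h.exists_isCrossing a
  set S := signlessEnergy (graph θ ω) f
  have hS : 0 ≤ S := signlessEnergy_nonneg _ f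
  have hN := hU.one_le
  have hdegree := h.sum_degree_mul_sq_le hU hG ht fun x => |f x|
  simp only [sq_abs] at hdegree
  have hmean : ∑ a, 𝔼 b ∈ cluster ω m₀ (a + red M (t a)), f b ^ 2 ≤ overlap d k₀ * S / ℓ ^ 2 :=
    calc _ ≤ ∑ a : Fin d → ZMod M, localSum ω θ k₀ a (fun x y => (f x + f y) ^ 2) / ℓ ^ 2 :=
          Finset.sum_le_sum fun a _ => h.expect_sq_le_signless hℓ (ht a).mem_box_succ
            ((ht a).mem_populated h.two_le_dim) f
      _ ≤ _ := by
          rw [← Finset.sum_div]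
          gcongr
          exact sum_localSum_le fun _ _ => sq_nonneg _
  have hdiscard : 0 ≤ 6 * (N / ℓ) ^ 2 * (overlap d k₀ *
    (d ^ 2 * M ^ 2 * ((Grid.box d (localRadius d k₀ + 1)).card : ℝ) ^ 3)) * S := by positivity
  calc _ ≤ _ := hdegree
    _ ≤ (1 + 24 * N ^ 3 * overlap d k₀) * S + 6 * N ^ 2 * (overlap d k₀ * S / ℓ ^ 2) := by
        gcongr
        exact energy_abs_le_signlessEnergy _ f
    _ = (1 + 24 * N ^ 3 * overlap d k₀ + 6 * (N / ℓ) ^ 2 * overlap d k₀) * S := by ring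
    _ ≤ poincareConst d k₀ M N ℓ * S := by
        rw [poincareConst]
        linarith

theorem Regular.sq_expect_sub_expect_le (h : Regular ω M θ m₀ ℓ k₀) (a : Fin d → ZMod M)
    {u v : Fin d → ℤ} (huv : (within (SimpleGraph.hasse _)
      (populated ω m₀ ℓ a ∩ Grid.box d (localRadius d k₀ + 1))).Adj u v) (f : Fin n → ℝ) :
    (𝔼 b ∈ cluster ω m₀ (a + red M u), f b - 𝔼 b ∈ cluster ω m₀ (a + red M v), f b) ^ 2
      ≤ localSum ω θ k₀ a (fun x y => (f x - f y) ^ 2) / ℓ ^ 2 := by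
  obtain ⟨⟨hpopu, hu⟩, ⟨hpopv, -⟩, hadj⟩ := within_adj.1 huv
  exact (_root_.sq_expect_sub_expect_le (cluster_nonempty h.one_le hpopu)
    (cluster_nonempty h.one_le hpopv) f).trans
    (h.expect_expect_sq_sub_le hu hpopu hpopv (norm_pt_sub_pt_le_of_hasse_adj a hadj) f)

theorem populated_add_single (a : Fin d → ZMod M) (j : Fin d) (v : Fin d → ℤ) :
    v + Pi.single j 1 ∈ populated ω m₀ ℓ a ↔ v ∈ populated ω m₀ ℓ (a + Pi.single j 1) := by
  rw [populated, populated, Set.mem_ofPred_eq, Set.mem_ofPred_eq, red_add, red_single,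
    add_comm (red M v), ← add_assoc]

theorem Regular.reachable_crossing (h : Regular ω M θ m₀ ℓ k₀) {a : Fin d → ZMod M} {j : Fin d}
    {t t' : Fin d → ℤ} (ht : IsCrossing ω m₀ ℓ k₀ a t)
    (ht' : IsCrossing ω m₀ ℓ k₀ (a + Pi.single j 1) t') :
    (within (SimpleGraph.hasse _)
      (populated ω m₀ ℓ a ∩ Grid.box d (localRadius d k₀ + 1))).Reachable
        t (t' + Pi.single j 1) := by
  have : Nontrivial (Fin d) := Fin.nontrivial_iff_two_le.2 h.two_le_dim
  obtain ⟨i, hij⟩ := exists_ne j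
  obtain ⟨b, ⟨hb0, hbk⟩, hslab⟩ := Grid.exists_slab_subset (h.sparse a) i
  set R := localRadius d k₀
  have hbR : -(R : ℤ) ≤ b ∧ b ≤ R := by have := lt_localRadius d k₀; omega
  set e : Fin d → ℤ := Pi.single j 1
  have hupdate : Function.update (t' + e) i b - e = Function.update t' i b := by
    ext k
    obtain rfl | hk := eq_or_ne k i
    · simp [e, hij]
    · simp [hk]
  rw [Grid.coe_box]
  refine Grid.reachable_of_slabs (l₁ := -(R : Fin d → ℤ)) (u₁ := R) (l₂ := -(R : Fin d → ℤ) + e)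
    (u₂ := R + e) (b := b) ?_ ?_ hij ?_ ?_ ?_ ?_ ?_ ?_ ?_
  · rw [← Grid.coe_box, ← Grid.coe_box, Finset.coe_subset]
    exact Grid.box_mono R.le_succ
  · rw [← Grid.coe_box]
    intro v hv
    rw [← sub_add_cancel v e]
    exact Grid.add_mem_box (Grid.mem_Icc_add.1 hv) (Grid.single_mem_box j 1)
  · rw [← Grid.coe_box]
    exact hslab
  · rw [← Grid.coe_box]
    exact ht.slab j
  · intro v hv hvj
    rw [← sub_add_cancel v e, populated_add_single]
    refine ht'.slab j _ (Grid.mem_Icc_add.1 hv) ?_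
    rw [Pi.sub_apply, hvj, Pi.add_apply, add_sub_cancel_right]
  · rw [← Grid.coe_box]
    exact ht.mem_box
  · rw [Grid.mem_Icc_add, add_sub_cancel_right]
    exact ht'.mem_box
  · rw [← Grid.coe_box]
    exact Grid.update_mem_box ht.mem_box i hbR
  · rw [Grid.mem_Icc_add, hupdate]
    exact Grid.update_mem_box ht'.mem_box i hbR

theorem Regular.sq_shift_expect_sub_le (h : Regular ω M θ m₀ ℓ k₀) (f : Fin n → ℝ)
    {t : (Fin d → ZMod M) → Fin d → ℤ} (ht : ∀ a, IsCrossing ω m₀ ℓ k₀ a (t a))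
    (a : Fin d → ZMod M) (j : Fin d) :
    (𝔼 b ∈ cluster ω m₀ (a + Pi.single j 1 + red M (t (a + Pi.single j 1))), f b
      - 𝔼 b ∈ cluster ω m₀ (a + red M (t a)), f b) ^ 2
      ≤ (Grid.box d (localRadius d k₀ + 1)).card ^ 3
        * (localSum ω θ k₀ a (fun x y => (f x - f y) ^ 2) / ℓ ^ 2) := by
  set Q := Grid.box d (localRadius d k₀ + 1)
  set D := localSum ω θ k₀ a (fun x y => (f x - f y) ^ 2) / ℓ ^ 2
  set g : (Fin d → ℤ) → ℝ := fun v => 𝔼 b ∈ cluster ω m₀ (a + red M v), f b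
  set H := within (SimpleGraph.hasse _) (populated ω m₀ ℓ a ∩ Q)
  have hD : 0 ≤ D := div_nonneg (localSum_nonneg a fun _ _ => sq_nonneg _) (sq_nonneg ℓ)
  have hH : ∀ u v, H.Adj u v → u ∈ Q := fun _ _ huv => (within_adj.1 huv).1.2
  have hsum : dartSum H Q Q (fun u v => (g u - g v) ^ 2) ≤ Q.card ^ 2 * D := by
    classical
    calc dartSum H Q Q (fun u v => (g u - g v) ^ 2) ≤ ∑ _u ∈ Q, ∑ _v ∈ Q, D := by
          refine Finset.sum_le_sum fun u _ => Finset.sum_le_sum fun v _ => ?_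
          split_ifs with huv
          exacts [h.sq_expect_sub_expect_le a huv f, hD]
      _ = Q.card ^ 2 * D := by
          simp only [Finset.sum_const, nsmul_eq_mul]
          ring
  have hshift : a + Pi.single j 1 + red M (t (a + Pi.single j 1))
      = a + red M (t (a + Pi.single j 1) + Pi.single j 1) := by
    rw [red_add, red_single, add_assoc, add_comm (Pi.single j 1)]
  rw [hshift, ← neg_sub, neg_sq]
  calc _ ≤ _ := sq_sub_le_of_reachable hH g (h.reachable_crossing (ht a) (ht _))
    _ ≤ Q.card * (Q.card ^ 2 * D) := by gcongr
    _ = _ := by ring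

theorem Regular.sum_expect_sub_sq_le (h : Regular ω M θ m₀ ℓ k₀) (f : Fin n → ℝ)
    {t : (Fin d → ZMod M) → Fin d → ℤ} (ht : ∀ a, IsCrossing ω m₀ ℓ k₀ a (t a)) :
    ∃ c, ∑ a, 𝔼 b ∈ cluster ω m₀ (a + red M (t a)), (f b - c) ^ 2
      ≤ overlap d k₀ * (d ^ 2 * M ^ 2 * (Grid.box d (localRadius d k₀ + 1)).card ^ 3 + 1)
        * energy (graph θ ω) f / ℓ ^ 2 := by
  set Λ := (Grid.box d (localRadius d k₀ + 1)).card
  set D : (Fin d → ZMod M) → ℝ := fun a => localSum ω θ k₀ a (fun x y => (f x - f y) ^ 2) / ℓ ^ 2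
  set g : (Fin d → ZMod M) → ℝ := fun a => 𝔼 b ∈ cluster ω m₀ (a + red M (t a)), f b
  have hpop a := (ht a).mem_populated h.two_le_dim
  have hcell (a) (c : ℝ) :
      𝔼 b ∈ cluster ω m₀ (a + red M (t a)), (f b - c) ^ 2 ≤ (g a - c) ^ 2 + D a := by
    rw [expect_sub_sq_eq (cluster_nonempty h.one_le (hpop a))]
    have := h.expect_expect_sq_sub_le (ht a).mem_box_succ (hpop a) (hpop a)
      (by simpa using mesh_pos.le) f
    have hD : 0 ≤ D a := div_nonneg (localSum_nonneg a fun _ _ => sq_nonneg _) (sq_nonneg ℓ)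
    linarith
  have hDsum : ∑ a, D a ≤ overlap d k₀ * energy (graph θ ω) f / ℓ ^ 2 := by
    rw [← Finset.sum_div]
    gcongr
    exact sum_localSum_le fun _ _ => sq_nonneg _
  have htorus : ∑ a, (g a - 𝔼 b, g b) ^ 2 ≤ d * M ^ 2 * (d * (Λ ^ 3 * ∑ a, D a)) := by
    refine (sum_sub_expect_sq_le_of_torus g).trans ?_
    gcongr
    calc ∑ a, ∑ j, (g (a + Pi.single j 1) - g a) ^ 2 ≤ ∑ a, ∑ _j : Fin d, Λ ^ 3 * D a :=
          Finset.sum_le_sum fun a _ => Finset.sum_le_sum fun j _ =>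
            h.sq_shift_expect_sub_le f ht a j
      _ = d * (Λ ^ 3 * ∑ a, D a) := by
          simp only [Finset.sum_const, Finset.card_univ, Fintype.card_fin, nsmul_eq_mul,
            Finset.mul_sum]
  refine ⟨𝔼 b, g b, ?_⟩
  calc _ ≤ ∑ a, ((g a - 𝔼 b, g b) ^ 2 + D a) := Finset.sum_le_sum fun a _ => hcell a _
    _ ≤ (d ^ 2 * M ^ 2 * Λ ^ 3 + 1) * ∑ a, D a := by
        rw [Finset.sum_add_distrib]
        linarith
    _ ≤ (d ^ 2 * M ^ 2 * Λ ^ 3 + 1) * (overlap d k₀ * energy (graph θ ω) f / ℓ ^ 2) := by gcongr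
    _ = _ := by ring

open Classical in
theorem Regular.poincare (h : Regular ω M θ m₀ ℓ k₀) (hU : Uncrowded ω M θ N k₀)
    (hG : (graph θ ω).Connected) {f : Fin n → ℝ} (hf : ∑ x, ((graph θ ω).degree x : ℝ) * f x = 0) :
    ∑ x, ((graph θ ω).degree x : ℝ) * f x ^ 2
      ≤ poincareConst d k₀ M N ℓ * energy (graph θ ω) f := by
  choose t ht using fun a : Fin d → ZMod M => h.exists_isCrossing a
  obtain ⟨c, hc⟩ := h.sum_expect_sub_sq_le f ht
  have hdegree := h.sum_degree_mul_sq_le hU hG ht fun x => f x - c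
  rw [energy_sub_const] at hdegree
  calc _ ≤ _ := sum_degree_mul_sq_le_sum_degree_mul_sub_sq _ hf c
    _ ≤ _ := hdegree
    _ ≤ _ := add_le_add_right (mul_le_mul_of_nonneg_left hc (by positivity)) _
    _ = poincareConst d k₀ M N ℓ * energy (graph θ ω) f := by
        rw [poincareConst]
        ring

end Poincare

end GTG

/-! ### Typical configurations -/

section Chernoff

theorem exp_indicator_const {X : Type*} (S : Set X) (u : ℝ) (x : X) :
    Real.exp (S.indicator (fun _ => u) x) = 1 + S.indicator (fun _ => Real.exp u - 1) x := by
  by_cases hx : x ∈ S <;> simp [hx]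

variable {X : Type*} [MeasurableSpace X] {μ : Measure X} {S : Set X}

theorem measureReal_exists_mem_le {ι : Type*} {s : Finset ι} {p : ι → X → Prop}
    {b : ℝ} (h : ∀ i ∈ s, μ.real {x | p i x} ≤ b) :
    μ.real {x | ∃ i ∈ s, p i x} ≤ s.card * b := by
  have hset : {x | ∃ i ∈ s, p i x} = ⋃ i ∈ s, {x | p i x} := by
    ext
    simp
  rw [hset, ← nsmul_eq_mul]
  exact (measureReal_biUnion_finset_le _ _).trans (Finset.sum_le_card_nsmul _ _ _ h)

variable [IsProbabilityMeasure μ]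

theorem integrable_exp_indicator_const (hS : MeasurableSet S) (u : ℝ) :
    Integrable (fun x => Real.exp (S.indicator (fun _ => u) x)) μ := by
  simp only [exp_indicator_const]
  exact (integrable_const _).add ((integrable_const _).indicator hS)

theorem integral_exp_indicator_const (hS : MeasurableSet S) (u : ℝ) :
    ∫ x, Real.exp (S.indicator (fun _ => u) x) ∂μ = 1 + (Real.exp u - 1) * μ.real S := by
  simp only [exp_indicator_const]
  rw [integral_add (integrable_const _) ((integrable_const _).indicator hS), integral_indicator hS]
  simp [mul_comm]

variable {ι : Type*} [Fintype ι]

open Classical in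
theorem measureReal_pi_le_mul_card_le (hS : MeasurableSet S) (u s : ℝ) :
    (Measure.pi fun _ : ι => μ).real {ω | s ≤ u * (Finset.univ.filter fun i => ω i ∈ S).card}
      ≤ Real.exp (-s + Fintype.card ι * ((Real.exp u - 1) * μ.real S)) := by
  set g : X → ℝ := fun x => Real.exp (S.indicator (fun _ => u) x)
  have hprod (ω : ι → X) :
      ∏ i, g (ω i) = Real.exp (u * (Finset.univ.filter fun i => ω i ∈ S).card) := by
    simp only [g, ← Real.exp_sum, Set.indicator_apply, ← Finset.sum_filter, Finset.sum_const,
      nsmul_eq_mul, mul_comm u]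
  have hmarkov := mul_meas_ge_le_integral_of_nonneg (f := fun ω : ι → X => ∏ i, g (ω i))
    (Eventually.of_forall fun ω => Finset.prod_nonneg fun i _ => (Real.exp_pos _).le)
    (Integrable.fintype_prod fun _ => integrable_exp_indicator_const (μ := μ) hS u) (Real.exp s)
  rw [integral_fintype_prod_eq_pow g, integral_exp_indicator_const hS] at hmarkov
  simp only [hprod, Real.exp_le_exp] at hmarkov
  have hbase : 1 + (Real.exp u - 1) * μ.real S ≤ Real.exp ((Real.exp u - 1) * μ.real S) := by
    rw [add_comm]
    exact Real.add_one_le_exp _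
  have hbase_nonneg : 0 ≤ 1 + (Real.exp u - 1) * μ.real S := by
    rw [← integral_exp_indicator_const hS]
    exact integral_nonneg fun x => (Real.exp_pos _).le
  rw [Real.exp_add, Real.exp_neg, Real.exp_nat_mul, ← div_eq_inv_mul, le_div_iff₀' (Real.exp_pos s)]
  exact hmarkov.trans (pow_le_pow_left₀ hbase_nonneg hbase _)

open Classical in
theorem measureReal_pi_le_card_le (hS : MeasurableSet S) (s : ℝ) :
    (Measure.pi fun _ : ι => μ).real {ω | s ≤ (Finset.univ.filter fun i => ω i ∈ S).card}
      ≤ Real.exp (-s + 2 * (Fintype.card ι * μ.real S)) := by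
  have h := measureReal_pi_le_mul_card_le (μ := μ) (ι := ι) hS 1 s
  simp only [one_mul] at h
  refine h.trans (Real.exp_le_exp.2 ?_)
  have hcount : 0 ≤ Fintype.card ι * μ.real S := by positivity
  nlinarith [Real.exp_one_lt_three]

open Classical in
theorem measureReal_pi_card_le_le (hS : MeasurableSet S) (s : ℝ) :
    (Measure.pi fun _ : ι => μ).real {ω | ((Finset.univ.filter fun i => ω i ∈ S).card : ℝ) ≤ s}
      ≤ Real.exp (s - Fintype.card ι * μ.real S / 2) := by
  have h := measureReal_pi_le_mul_card_le (μ := μ) (ι := ι) hS (-1) (-s)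
  simp only [neg_mul, one_mul, neg_le_neg_iff, neg_neg] at h
  refine h.trans (Real.exp_le_exp.2 ?_)
  have hcount : 0 ≤ Fintype.card ι * μ.real S := by positivity
  nlinarith [Real.exp_neg_one_lt_half]

end Chernoff

namespace GTG

variable {d n M : ℕ}

instance isProbabilityMeasure_volume_torus :
    IsProbabilityMeasure (volume : Measure (UnitAddTorus (Fin d))) := by
  have : IsProbabilityMeasure (volume : Measure UnitAddCircle) :=
    ⟨by rw [AddCircle.measure_univ, ENNReal.ofReal_one]⟩
  rw [volume_pi]
  infer_instance

instance isProbabilityMeasure_law (ρ : Measure ℝ) [IsProbabilityMeasure ρ] (n : ℕ) :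
    IsProbabilityMeasure (law d ρ n) := by
  unfold law
  infer_instance

theorem ae_law_weight_nonneg {ρ : Measure ℝ} [IsProbabilityMeasure ρ] (hρ : ∀ᵐ w ∂ρ, 0 ≤ w)
    (n : ℕ) : ∀ᵐ ω ∂law d ρ n, ∀ x, 0 ≤ (ω x).2 :=
  ae_all_iff.2 fun x => (Measure.quasiMeasurePreserving_eval
    (fun _ : Fin n => (volume : Measure (UnitAddTorus (Fin d))).prod ρ) x).ae
    (Measure.quasiMeasurePreserving_snd.ae hρ)

theorem volume_closedBall (x : UnitAddTorus (Fin d)) {r : ℝ} (hr : 0 ≤ r) :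
    volume.real (Metric.closedBall x r) = min 1 (2 * r) ^ d := by
  have hmin : 0 ≤ min 1 (2 * r) := le_min one_pos.le (by positivity)
  rw [Measure.real, volume_pi_closedBall x hr]
  simp_rw [AddCircle.volume_closedBall]
  rw [Finset.prod_const, Finset.card_univ, Fintype.card_fin, ← ENNReal.ofReal_pow hmin,
    ENNReal.toReal_ofReal (pow_nonneg hmin d)]

theorem red_injOn_box {r : ℕ} (hr : 2 * r < M) :
    Set.InjOn (red M) (Grid.box d r : Set (Fin d → ℤ)) := by
  intro v hv v' hv' h
  ext i
  have hdvd : (M : ℤ) ∣ v' i - v i := (ZMod.intCast_eq_intCast_iff_dvd_sub ..).1 (congrFun h i)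
  have hvi := Grid.mem_box.1 hv i
  have hvi' := Grid.mem_box.1 hv' i
  have := Int.eq_zero_of_abs_lt_dvd hdvd (abs_lt.2 (by omega))
  omega

variable [NeZero M] {a b : Fin d → ZMod M}

theorem mesh_le_norm_pt_sub_pt (hab : a ≠ b) : mesh M ≤ ‖pt a - pt b‖ := by
  obtain ⟨i, hi⟩ := Function.ne_iff.1 hab
  obtain ⟨k, hk, hnorm⟩ := exists_intCast_eq_and_norm_toAddCircle_eq (a i - b i)
  have hk0 : k ≠ 0 := by
    rintro rfl
    exact hi (sub_eq_zero.1 (by rw [← hk, Int.cast_zero]))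
  refine le_trans ?_ (norm_le_pi_norm (pt a - pt b) i)
  rw [Pi.sub_apply, pt, pt, ← map_sub, hnorm, mesh]
  gcongr
  exact_mod_cast Int.one_le_abs hk0

/-- The positions and weights that put a node in the cluster at the lattice point of index `a`. -/
def clusterRegion (m₀ : ℝ) (a : Fin d → ZMod M) : Set (UnitAddTorus (Fin d) × ℝ) :=
  Metric.closedBall (pt a) (mesh M / 3) ×ˢ Set.Ici m₀

theorem measurableSet_clusterRegion (m₀ : ℝ) (a : Fin d → ZMod M) :
    MeasurableSet (clusterRegion m₀ a) :=
  measurableSet_closedBall.prod measurableSet_Ici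

theorem mem_cluster_iff_mem_clusterRegion {ω : Config d n} {m₀ : ℝ} {x : Fin n} :
    x ∈ cluster ω m₀ a ↔ ω x ∈ clusterRegion m₀ a := by
  rw [mem_cluster, clusterRegion, Set.mem_prod, Metric.mem_closedBall, dist_eq_norm, and_comm,
    Set.mem_Ici]

theorem measureReal_clusterRegion (ρ : Measure ℝ) [IsProbabilityMeasure ρ] (m₀ : ℝ)
    (a : Fin d → ZMod M) :
    ((volume : Measure (UnitAddTorus (Fin d))).prod ρ).real (clusterRegion m₀ a)
      = (2 * mesh M / 3) ^ d * ρ.real (Set.Ici m₀) := by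
  have hmesh : mesh M ≤ 1 := by
    rw [mesh]
    exact div_le_self one_pos.le (Nat.one_le_cast.2 (NeZero.pos M))
  have hmesh_pos := mesh_pos (M := M)
  rw [clusterRegion, measureReal_prod_prod, volume_closedBall _ (by positivity),
    min_eq_right (by linarith), mul_div_assoc]

theorem disjoint_clusterRegion (m₀ : ℝ) (hab : a ≠ b) :
    Disjoint (clusterRegion m₀ a) (clusterRegion m₀ b) := by
  refine Set.disjoint_prod.2 (Or.inl (Metric.closedBall_disjoint_closedBall ?_))
  rw [dist_eq_norm]
  linarith [mesh_le_norm_pt_sub_pt hab, mesh_pos (M := M)]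

theorem measureReal_biUnion_clusterRegion (ρ : Measure ℝ) [IsProbabilityMeasure ρ] (m₀ : ℝ)
    (A : Finset (Fin d → ZMod M)) :
    ((volume : Measure (UnitAddTorus (Fin d))).prod ρ).real (⋃ a ∈ A, clusterRegion m₀ a)
      = A.card * ((2 * mesh M / 3) ^ d * ρ.real (Set.Ici m₀)) := by
  rw [measureReal_biUnion_finset (fun a _ b _ hab => disjoint_clusterRegion m₀ hab)
    fun a _ => measurableSet_clusterRegion m₀ a]
  simp_rw [measureReal_clusterRegion, Finset.sum_const, nsmul_eq_mul]

open Classical in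
theorem card_filter_mem_biUnion_clusterRegion_le {ω : Config d n} {m₀ ℓ : ℝ}
    {A : Finset (Fin d → ZMod M)} (hA : ∀ a ∈ A, ((cluster ω m₀ a).card : ℝ) ≤ ℓ) :
    ((Finset.univ.filter fun x => ω x ∈ ⋃ a ∈ A, clusterRegion m₀ a).card : ℝ)
      ≤ A.card * ℓ := by
  have hsub : (Finset.univ.filter fun x => ω x ∈ ⋃ a ∈ A, clusterRegion m₀ a)
      ⊆ A.biUnion (cluster ω m₀) := fun x hx => by
    obtain ⟨a, ha, hxa⟩ := Set.mem_iUnion₂.1 (Finset.mem_filter.1 hx).2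
    exact Finset.mem_biUnion.2 ⟨a, ha, mem_cluster_iff_mem_clusterRegion.2 hxa⟩
  calc ((Finset.univ.filter fun x => ω x ∈ ⋃ a ∈ A, clusterRegion m₀ a).card : ℝ)
      ≤ ∑ a ∈ A, ((cluster ω m₀ a).card : ℝ) := by
        exact_mod_cast (Finset.card_le_card hsub).trans Finset.card_biUnion_le
    _ ≤ A.card * ℓ := by
        rw [← nsmul_eq_mul]
        exact Finset.sum_le_card_nsmul _ _ _ hA

theorem law_forall_card_cluster_le_le (ρ : Measure ℝ) [IsProbabilityMeasure ρ] (n : ℕ) (m₀ ℓ : ℝ)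
    (A : Finset (Fin d → ZMod M)) :
    (law d ρ n).real {ω | ∀ a ∈ A, ((cluster ω m₀ a).card : ℝ) ≤ ℓ}
      ≤ Real.exp (A.card * (ℓ - n * ((2 * mesh M / 3) ^ d * ρ.real (Set.Ici m₀)) / 2)) := by
  refine (measureReal_mono (fun ω hω => card_filter_mem_biUnion_clusterRegion_le hω)
    (measure_ne_top _ _)).trans ?_
  refine (measureReal_pi_card_le_le (A.measurableSet_biUnion fun a _ =>
    measurableSet_clusterRegion m₀ a) _).trans (Real.exp_le_exp.2 (le_of_eq ?_))
  rw [measureReal_biUnion_clusterRegion, Fintype.card_fin]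
  ring

open Classical in
theorem law_exists_not_sparse_le (ρ : Measure ℝ) [IsProbabilityMeasure ρ] (n : ℕ) (m₀ ℓ : ℝ)
    (k₀ : ℕ) {r : ℕ} (hr : 2 * r < M) :
    (law d ρ n).real {ω | ∃ a : Fin d → ZMod M,
        k₀ < ((Grid.box d r).filter (· ∉ populated ω m₀ ℓ a)).card}
      ≤ M ^ d * (2 ^ (Grid.box d r).card * Real.exp ((k₀ + 1) *
        (ℓ - n * ((2 * mesh M / 3) ^ d * ρ.real (Set.Ici m₀)) / 2))) := by
  set shift : (Fin d → ZMod M) → Finset (Fin d → ℤ) → Finset (Fin d → ZMod M) :=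
    fun a T => T.image fun v => a + red M v
  have hsub (ω : Config d n) (hω : ∃ a : Fin d → ZMod M,
      k₀ < ((Grid.box d r).filter (· ∉ populated ω m₀ ℓ a)).card) :
      ∃ a ∈ (Finset.univ : Finset (Fin d → ZMod M)), ∃ T ∈ (Grid.box d r).powersetCard (k₀ + 1),
        ∀ b ∈ shift a T, ((cluster ω m₀ b).card : ℝ) ≤ ℓ := by
    obtain ⟨a, ha⟩ := hω
    obtain ⟨T, hT, hcard⟩ := Finset.exists_subset_card_eq (Nat.succ_le_of_lt ha)
    refine ⟨a, Finset.mem_univ a, T,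
      Finset.mem_powersetCard.2 ⟨hT.trans (Finset.filter_subset _ _), hcard⟩, ?_⟩
    refine Finset.forall_mem_image.2 fun v hv => ?_
    exact (not_le.1 (Finset.mem_filter.1 (hT hv)).2).le
  have hshift (a : Fin d → ZMod M) (T) (hT : T ∈ (Grid.box d r).powersetCard (k₀ + 1)) :
      (shift a T).card = k₀ + 1 := by
    obtain ⟨hTr, hcard⟩ := Finset.mem_powersetCard.1 hT
    rw [← hcard]
    refine Finset.card_image_of_injOn fun v hv v' hv' h => ?_
    exact red_injOn_box hr (hTr hv) (hTr hv') (add_left_cancel h)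
  have hsets : ((Grid.box d r).powersetCard (k₀ + 1)).card ≤ 2 ^ (Grid.box d r).card := by
    rw [Finset.card_powersetCard]
    exact Nat.choose_le_two_pow _ _
  have hbound (a : Fin d → ZMod M) (T) (hT : T ∈ (Grid.box d r).powersetCard (k₀ + 1)) :
      (law d ρ n).real {ω | ∀ b ∈ shift a T, ((cluster ω m₀ b).card : ℝ) ≤ ℓ}
        ≤ Real.exp ((k₀ + 1) * (ℓ - n * ((2 * mesh M / 3) ^ d * ρ.real (Set.Ici m₀)) / 2)) := by
    have h := law_forall_card_cluster_le_le ρ n m₀ ℓ (shift a T)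
    rwa [hshift a T hT, Nat.cast_add, Nat.cast_one] at h
  refine (measureReal_mono (Set.ofPred_subset_ofPred.2 hsub) (measure_ne_top _ _)).trans ?_
  refine (measureReal_exists_mem_le fun a _ => measureReal_exists_mem_le (hbound a)).trans ?_
  rw [Finset.card_univ, Fintype.card_fun, ZMod.card, Fintype.card_fin, Nat.cast_pow]
  gcongr
  exact_mod_cast hsets

/-- The positions and weights of the nodes that may be joined to a node of no larger weight within
`r` mesh steps of the lattice point of index `a`. The absolute value makes the radius meaningful
for every real weight; the weights of the model are almost surely nonnegative. -/
def reaching (θ : ℝ) (r : ℕ) (a : Fin d → ZMod M) : Set (UnitAddTorus (Fin d) × ℝ) :=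
  {q | ‖q.1 - pt a‖ ≤ (2 * |q.2| / θ) ^ ((d : ℝ)⁻¹) + r * mesh M}

theorem measurableSet_reaching (θ : ℝ) (r : ℕ) (a : Fin d → ZMod M) :
    MeasurableSet (reaching θ r a) := by
  refine measurableSet_le (measurable_fst.sub_const _).norm ?_
  exact (((measurable_snd.abs.const_mul 2).div_const θ).pow_const _).add_const _

theorem volume_preimage_reaching_le (hd : d ≠ 0) {θ : ℝ} (hθ : 0 < θ) (r : ℕ)
    (a : Fin d → ZMod M) (w : ℝ) :
    volume.real ((fun x : UnitAddTorus (Fin d) => (x, w)) ⁻¹' reaching θ r a)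
      ≤ 4 ^ d * (2 * |w| / θ + (r * mesh M) ^ d) := by
  have hmesh := mesh_pos (M := M)
  set R := (2 * |w| / θ) ^ ((d : ℝ)⁻¹) with hR
  have hR_nonneg : 0 ≤ R := by positivity
  have hR_pow : R ^ d = 2 * |w| / θ := Real.rpow_inv_natCast_pow (by positivity) hd
  have hball : (fun x : UnitAddTorus (Fin d) => (x, w)) ⁻¹' reaching θ r a
      = Metric.closedBall (pt a) (R + r * mesh M) := by
    ext x
    simp [reaching, dist_eq_norm, hR]
  calc volume.real ((fun x : UnitAddTorus (Fin d) => (x, w)) ⁻¹' reaching θ r a)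
      ≤ (2 * (R + r * mesh M)) ^ d := by
        rw [hball, volume_closedBall _ (by positivity)]
        exact pow_le_pow_left₀ (le_min one_pos.le (by positivity)) (min_le_right _ _) d
    _ = 2 ^ d * (R + r * mesh M) ^ d := mul_pow _ _ _
    _ ≤ 2 ^ d * (2 ^ (d - 1) * (R ^ d + (r * mesh M) ^ d)) := by
        gcongr
        exact add_pow_le hR_nonneg (by positivity) d
    _ ≤ 2 ^ d * (2 ^ d * (R ^ d + (r * mesh M) ^ d)) := by
        gcongr
        · norm_num
        · exact Nat.sub_le d 1
    _ = 4 ^ d * (2 * |w| / θ + (r * mesh M) ^ d) := by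
        rw [hR_pow, ← mul_assoc, ← mul_pow]
        norm_num

theorem measureReal_reaching_le (hd : d ≠ 0) {ρ : Measure ℝ} [IsProbabilityMeasure ρ]
    (hρ : Integrable (fun w => w) ρ) {θ : ℝ} (hθ : 0 < θ) (r : ℕ) (a : Fin d → ZMod M) :
    ((volume : Measure (UnitAddTorus (Fin d))).prod ρ).real (reaching θ r a)
      ≤ 4 ^ d * (2 * (∫ w, |w| ∂ρ) / θ + (r * mesh M) ^ d) := by
  have hbound : Integrable (fun w => 4 ^ d * (2 * |w| / θ + (r * mesh M) ^ d)) ρ :=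
    (((hρ.abs.const_mul 2).div_const θ).add (integrable_const _)).const_mul _
  calc ((volume : Measure (UnitAddTorus (Fin d))).prod ρ).real (reaching θ r a)
      = ∫ w, volume.real ((fun x => (x, w)) ⁻¹' reaching θ r a) ∂ρ := by
        rw [Measure.real, Measure.prod_apply_symm (measurableSet_reaching θ r a)]
        exact (integral_toReal
          (measurable_measure_prodMk_right (measurableSet_reaching θ r a)).aemeasurable
          (Eventually.of_forall fun w => measure_lt_top _ _)).symm
    _ ≤ ∫ w, 4 ^ d * (2 * |w| / θ + (r * mesh M) ^ d) ∂ρ :=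
        integral_mono_of_nonneg (Eventually.of_forall fun w => measureReal_nonneg) hbound
          (Eventually.of_forall (volume_preimage_reaching_le hd hθ r a))
    _ = 4 ^ d * (2 * (∫ w, |w| ∂ρ) / θ + (r * mesh M) ^ d) := by
        rw [integral_const_mul, integral_add ((hρ.abs.const_mul 2).div_const θ)
          (integrable_const _), integral_div, integral_const_mul, integral_const, probReal_univ,
          one_smul]

open Classical in
theorem law_exists_le_card_reaching_le (hd : d ≠ 0) {ρ : Measure ℝ} [IsProbabilityMeasure ρ]
    (hρ : Integrable (fun w => w) ρ) (n : ℕ) {θ : ℝ} (hθ : 0 < θ) (r : ℕ) (s : ℝ) :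
    (law d ρ n).real {ω | ∃ a : Fin d → ZMod M,
        s ≤ (Finset.univ.filter fun x => ω x ∈ reaching θ r a).card}
      ≤ M ^ d * Real.exp (-s + 2 * (n * (4 ^ d * (2 * (∫ w, |w| ∂ρ) / θ + (r * mesh M) ^ d)))) := by
  have hpoint (a : Fin d → ZMod M) : (law d ρ n).real
      {ω | s ≤ (Finset.univ.filter fun x => ω x ∈ reaching θ r a).card}
      ≤ Real.exp (-s + 2 * (n * (4 ^ d * (2 * (∫ w, |w| ∂ρ) / θ + (r * mesh M) ^ d)))) := by
    refine (measureReal_pi_le_card_le (measurableSet_reaching θ r a) s).trans ?_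
    rw [Fintype.card_fin]
    gcongr
    exact measureReal_reaching_le hd hρ hθ r a
  have h := measureReal_exists_mem_le (s := Finset.univ) fun a _ => hpoint a
  rw [Finset.card_univ, Fintype.card_fun, ZMod.card, Fintype.card_fin, Nat.cast_pow] at h
  simpa only [Finset.mem_univ, true_and] using h

end GTG

/-! ### Asymptotics of the mixing time -/

namespace GTG

variable {d : ℕ}

theorem le_rpow_inv_of_pow_le (hd : d ≠ 0) {x y : ℝ} (hx : 0 ≤ x) (h : x ^ d ≤ y) :
    x ≤ y ^ ((d : ℝ)⁻¹) := by
  rw [← Real.pow_rpow_inv_natCast hx hd]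
  exact Real.rpow_le_rpow (pow_nonneg hx d) h (by positivity)

section Uncrowded

variable {n M : ℕ} [NeZero M] {ω : Config d n} {θ : ℝ}

theorem mem_reaching_of_adj (hd : d ≠ 0) (hθ : 0 < θ) {r : ℕ} (hr : 1 ≤ r) {a : Fin d → ZMod M}
    {x y : Fin n} (hxy : (graph θ ω).Adj x y) (hw : (ω x).2 ≤ (ω y).2)
    (ha : ‖(ω x).1 - pt a‖ ≤ mesh M) : ω y ∈ reaching θ r a := by
  have hpow : toricDist (ω y).1 (ω x).1 ^ d ≤ 2 * |(ω y).2| / θ := by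
    rw [le_div_iff₀' hθ, toricDist_comm]
    linarith [hxy.2, le_abs_self (ω y).2]
  calc ‖(ω y).1 - pt a‖ ≤ ‖(ω y).1 - (ω x).1‖ + ‖(ω x).1 - pt a‖ :=
        norm_sub_le_norm_sub_add_norm_sub _ _ _
    _ ≤ (2 * |(ω y).2| / θ) ^ ((d : ℝ)⁻¹) + mesh M :=
        add_le_add ((norm_sub_le_toricDist _ _).trans
          (le_rpow_inv_of_pow_le hd (toricDist_nonneg _ _) hpow)) ha
    _ ≤ (2 * |(ω y).2| / θ) ^ ((d : ℝ)⁻¹) + r * mesh M :=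
        add_le_add_right (le_mul_of_one_le_left mesh_pos.le (Nat.one_le_cast.2 hr)) _

open Classical in
theorem Uncrowded.of_card_reaching_le (hd : d ≠ 0) (hθ : 0 < θ) {N : ℝ} {k₀ : ℕ} (hN : 1 ≤ N)
    (h : ∀ a : Fin d → ZMod M,
      ((Finset.univ.filter fun x => ω x ∈ reaching θ (localRadius d k₀ + 2) a).card : ℝ) ≤ N) :
    Uncrowded ω M θ N k₀ where
  one_le := hN
  card_near_le a := by
    refine le_trans (Nat.cast_le.2 (Finset.card_le_card fun x hx => ?_)) (h a)
    refine Finset.mem_filter.2 ⟨Finset.mem_univ x, (mem_near.1 hx).trans ?_⟩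
    exact le_add_of_nonneg_left (by positivity)
  card_heavier_le x := by
    obtain ⟨a, ha⟩ := exists_norm_sub_pt_le (M := M) (ω x).1
    refine le_trans (Nat.cast_le.2 (Finset.card_le_card fun y hy => ?_)) (h a)
    obtain ⟨hxy, hw⟩ := (Finset.mem_filter.1 hy).2
    exact Finset.mem_filter.2
      ⟨Finset.mem_univ y, mem_reaching_of_adj hd hθ (Nat.le_add_left 1 _) hxy hw ha⟩

end Uncrowded

section Whp

variable {ρ : Measure ℝ} {A B : (n : ℕ) → Set (Config d n)}

theorem Whp.inter (hA : Whp ρ A) (hB : Whp ρ B) : Whp ρ fun n => A n ∩ B n := by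
  have hsum := hA.add hB
  rw [add_zero] at hsum
  refine tendsto_of_tendsto_of_tendsto_of_le_of_le tendsto_const_nhds hsum (fun _ => zero_le) ?_
  intro n
  simp only [Set.compl_inter]
  exact measure_union_le _ _

theorem Whp.mono (hA : Whp ρ A) (h : ∀ᶠ n in atTop, A n ⊆ B n) : Whp ρ B :=
  tendsto_of_tendsto_of_tendsto_of_le_of_le' tendsto_const_nhds hA
    (Eventually.of_forall fun _ => zero_le)
    (h.mono fun _ hn => measure_mono (Set.compl_subset_compl.2 hn))

variable [IsProbabilityMeasure ρ]

theorem whp_of_eventually_measureReal_compl_le_div {C : ℝ}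
    (h : ∀ᶠ n : ℕ in atTop, (law d ρ n).real (A n)ᶜ ≤ C / n) : Whp ρ A := by
  have hlim := ENNReal.tendsto_ofReal (tendsto_const_div_atTop_nhds_zero_nat C)
  rw [ENNReal.ofReal_zero] at hlim
  refine tendsto_of_tendsto_of_tendsto_of_le_of_le' tendsto_const_nhds hlim
    (Eventually.of_forall fun _ => zero_le) (h.mono fun n hn => ?_)
  rw [← ofReal_measureReal]
  exact ENNReal.ofReal_le_ofReal hn

theorem whp_weight_nonneg (hρ : ∀ᵐ w ∂ρ, 0 ≤ w) :
    Whp ρ fun n => {ω : Config d n | ∀ x, 0 ≤ (ω x).2} :=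
  tendsto_const_nhds.congr fun n => (mem_ae_iff.1 (ae_law_weight_nonneg hρ n)).symm

end Whp

section MeshCount

/-- The number of lattice points per side of the torus, chosen so that the `n` nodes number about
`log n / B` per lattice cell. Rounding down and adding one keeps it positive for every `n`. -/
noncomputable def meshCount (d : ℕ) (B : ℝ) (n : ℕ) : ℕ :=
  ⌊(B * n / Real.log n) ^ ((d : ℝ)⁻¹)⌋₊ + 1

instance neZero_meshCount (d : ℕ) (B : ℝ) (n : ℕ) : NeZero (meshCount d B n) :=
  ⟨Nat.succ_ne_zero _⟩

theorem tendsto_log_natCast_atTop : Tendsto (fun n : ℕ => Real.log n) atTop atTop :=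
  Real.tendsto_log_atTop.comp tendsto_natCast_atTop_atTop

variable {B : ℝ}

theorem eventually_log_pow_le (hB : 0 < B) (k : ℕ) :
    ∀ᶠ n : ℕ in atTop, Real.log n ^ k ≤ B * n := by
  filter_upwards [tendsto_natCast_atTop_atTop.eventually
    ((Real.isLittleO_pow_log_id_atTop (n := k)).bound hB)] with n hn
  rw [id, Real.norm_natCast] at hn
  exact (le_abs_self _).trans hn

theorem rpow_inv_le_meshCount (d : ℕ) (B : ℝ) (n : ℕ) :
    (B * n / Real.log n) ^ ((d : ℝ)⁻¹) ≤ meshCount d B n := by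
  rw [meshCount]
  push_cast
  exact (Nat.lt_floor_add_one _).le

theorem eventually_log_sq_le_meshCount (hd : d ≠ 0) (hB : 0 < B) :
    ∀ᶠ n : ℕ in atTop, Real.log n ^ 2 ≤ meshCount d B n := by
  filter_upwards [tendsto_log_natCast_atTop.eventually_gt_atTop 0,
    eventually_log_pow_le hB (2 * d + 1)] with n hlog hpow
  refine (le_rpow_inv_of_pow_le hd (by positivity) ?_).trans (rpow_inv_le_meshCount d B n)
  rwa [le_div_iff₀ hlog, ← pow_mul, ← pow_succ]

theorem eventually_meshCount_le (hB : 0 < B) :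
    ∀ᶠ n : ℕ in atTop, (meshCount d B n : ℝ) ≤ 2 * (B * n / Real.log n) ^ ((d : ℝ)⁻¹) := by
  filter_upwards [tendsto_log_natCast_atTop.eventually_gt_atTop 0,
    eventually_log_pow_le hB 1] with n hlog hpow
  have hone : 1 ≤ (B * n / Real.log n) ^ ((d : ℝ)⁻¹) := by
    refine Real.one_le_rpow ?_ (by positivity)
    rwa [one_le_div hlog, ← pow_one (Real.log n)]
  rw [meshCount]
  push_cast
  linarith [Nat.floor_le (zero_le_one.trans hone)]

theorem eventually_meshCount_sq_le (hB : 0 < B) : ∀ᶠ n : ℕ in atTop,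
    (meshCount d B n : ℝ) ^ 2 ≤ 4 * (B * n / Real.log n) ^ ((2 : ℝ) / d) := by
  filter_upwards [eventually_meshCount_le (d := d) hB] with n hM
  have hq : 0 ≤ B * n / Real.log n := by positivity
  calc (meshCount d B n : ℝ) ^ 2 ≤ (2 * (B * n / Real.log n) ^ ((d : ℝ)⁻¹)) ^ 2 := by gcongr
    _ = 4 * (B * n / Real.log n) ^ ((2 : ℝ) / d) := by
      rw [mul_pow, ← Real.rpow_mul_natCast hq, Nat.cast_ofNat, inv_mul_eq_div]
      norm_num

theorem eventually_mul_mesh_pow_le (hd : d ≠ 0) (hB : 0 < B) :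
    ∀ᶠ n : ℕ in atTop, n * mesh (meshCount d B n) ^ d ≤ Real.log n / B := by
  filter_upwards [tendsto_log_natCast_atTop.eventually_gt_atTop 0] with n hlog
  have hM : 0 < (meshCount d B n : ℝ) := Nat.cast_pos.2 (NeZero.pos _)
  have hq : 0 ≤ B * n / Real.log n := by positivity
  have hpow : B * n / Real.log n ≤ (meshCount d B n : ℝ) ^ d := by
    rw [← Real.rpow_inv_natCast_pow hq hd]
    exact pow_le_pow_left₀ (by positivity) (rpow_inv_le_meshCount d B n) d
  rw [mesh, one_div, inv_pow, ← div_eq_mul_inv, div_le_div_iff₀ (by positivity) hB,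
    mul_comm (n : ℝ)]
  rwa [div_le_iff₀' hlog] at hpow

theorem eventually_le_mul_mesh_pow (hd : d ≠ 0) (hB : 0 < B) :
    ∀ᶠ n : ℕ in atTop, Real.log n / (2 ^ d * B) ≤ n * mesh (meshCount d B n) ^ d := by
  filter_upwards [tendsto_log_natCast_atTop.eventually_gt_atTop 0,
    eventually_meshCount_le (d := d) hB] with n hlog hM_le
  have hM : 0 < (meshCount d B n : ℝ) := Nat.cast_pos.2 (NeZero.pos _)
  have hq : 0 ≤ B * n / Real.log n := by positivity
  have hpow : (meshCount d B n : ℝ) ^ d ≤ 2 ^ d * (B * n / Real.log n) := by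
    rw [← Real.rpow_inv_natCast_pow hq hd, ← mul_pow]
    exact pow_le_pow_left₀ hM.le hM_le d
  rw [mesh, one_div, inv_pow, ← div_eq_mul_inv, div_le_div_iff₀ (by positivity) (by positivity)]
  rw [← mul_div_assoc, le_div_iff₀' hlog] at hpow
  linarith

theorem eventually_meshCount_pow_le (hd : d ≠ 0) (hB : 0 < B) :
    ∀ᶠ n : ℕ in atTop, (meshCount d B n : ℝ) ^ d ≤ n := by
  filter_upwards [eventually_le_mul_mesh_pow hd hB,
    tendsto_log_natCast_atTop.eventually_ge_atTop (2 ^ d * B)] with n hle hlog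
  have hM : 0 < (meshCount d B n : ℝ) := Nat.cast_pos.2 (NeZero.pos _)
  have hone : 1 ≤ n * mesh (meshCount d B n) ^ d :=
    ((one_le_div (by positivity)).2 hlog).trans hle
  rwa [mesh, one_div, inv_pow, ← div_eq_mul_inv, one_le_div (by positivity)] at hone

theorem eventually_lt_meshCount (hd : d ≠ 0) (hB : 0 < B) (k : ℕ) :
    ∀ᶠ n : ℕ in atTop, k < meshCount d B n := by
  filter_upwards [eventually_log_sq_le_meshCount hd hB,
    tendsto_log_natCast_atTop.eventually_gt_atTop (k + 1 : ℝ)] with n hM hlog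
  have : (k : ℝ) < meshCount d B n := by nlinarith
  exact_mod_cast this

end MeshCount

theorem mul_exp_le_one_div {n : ℕ} (hn : n ≠ 0) {x s : ℝ} (hx : x ≤ n)
    (hs : s ≤ -(2 * Real.log n)) : x * Real.exp s ≤ 1 / n := by
  have hn0 : (0 : ℝ) < n := by positivity
  calc x * Real.exp s ≤ n * Real.exp (-(2 * Real.log n)) := by gcongr
    _ = 1 / n := by
      rw [two_mul, neg_add, Real.exp_add, Real.exp_neg, Real.exp_log hn0]
      field_simp

section TypicalConfigurations

variable {ρ : Measure ℝ} [IsProbabilityMeasure ρ] {B c m₀ : ℝ}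

theorem eventually_mul_log_le_mean (hd : d ≠ 0) (hB : 0 < B) {p : ℝ} (hp : 0 ≤ p) :
    ∀ᶠ n : ℕ in atTop, 2 * (p / (4 * (3 ^ d * B)) * Real.log n) ≤
      n * ((2 * mesh (meshCount d B n) / 3) ^ d * p) / 2 := by
  filter_upwards [eventually_le_mul_mesh_pow hd hB] with n hmesh
  calc 2 * (p / (4 * (3 ^ d * B)) * Real.log n)
      = (2 / 3) ^ d * p * (Real.log n / (2 ^ d * B)) / 2 := by
        rw [div_pow]
        field_simp
        ring
    _ ≤ (2 / 3) ^ d * p * (n * mesh (meshCount d B n) ^ d) / 2 := by gcongr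
    _ = n * ((2 * mesh (meshCount d B n) / 3) ^ d * p) / 2 := by
        rw [mul_div_right_comm 2, mul_pow]
        ring

open Classical in
theorem whp_sparse (hd : d ≠ 0) (hB : 0 < B) (hm₀ : 0 < ρ.real (Set.Ici m₀)) :
    ∃ e > 0, ∃ k₀ : ℕ, Whp ρ fun n => {ω : Config d n | ∀ a : Fin d → ZMod (meshCount d B n),
      ((Grid.box d (localRadius d k₀ + 1)).filter
        (· ∉ populated ω m₀ (e * Real.log n) a)).card ≤ k₀} := by
  set p := ρ.real (Set.Ici m₀)
  set e := p / (4 * (3 ^ d * B))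
  have he : 0 < e := by positivity
  obtain ⟨k₀, hk₀⟩ := exists_nat_ge (2 / e)
  set r := localRadius d k₀ + 1
  refine ⟨e, he, k₀, whp_of_eventually_measureReal_compl_le_div
    (C := 2 ^ (Grid.box d r).card) ?_⟩
  filter_upwards [eventually_ne_atTop 0, eventually_mul_log_le_mean hd hB hm₀.le,
    eventually_meshCount_pow_le hd hB, eventually_lt_meshCount hd hB (2 * r)]
    with n hn hmean hpow hbox
  set M := meshCount d B n
  have hk₀e : 2 ≤ (k₀ + 1) * e := by
    rw [div_le_iff₀ he] at hk₀
    linarith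
  have hexp : (k₀ + 1) * (e * Real.log n - n * ((2 * mesh M / 3) ^ d * p) / 2)
      ≤ -(2 * Real.log n) :=
    calc (k₀ + 1) * (e * Real.log n - n * ((2 * mesh M / 3) ^ d * p) / 2)
        ≤ (k₀ + 1) * (-(e * Real.log n)) := by
          gcongr
          linarith
      _ ≤ -(2 * Real.log n) := by
          linarith [mul_le_mul_of_nonneg_right hk₀e (Real.log_natCast_nonneg n)]
  have hbad := law_exists_not_sparse_le (d := d) ρ n m₀ (e * Real.log n) k₀ hbox
  refine (measureReal_mono (fun ω hω => ?_) (measure_ne_top _ _)).trans (hbad.trans ?_)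
  · obtain ⟨a, ha⟩ := not_forall.1 hω
    exact ⟨a, not_le.1 ha⟩
  · rw [mul_left_comm, div_eq_mul_one_div (2 ^ (Grid.box d r).card) (n : ℝ)]
    exact mul_le_mul_of_nonneg_left (mul_exp_le_one_div hn hpow hexp) (by positivity)

theorem whp_regular (hd : 2 ≤ d) (hρ : ∀ᵐ w ∂ρ, 0 ≤ w) (hm₀ : 0 < m₀)
    (hm₀_mass : 0 < ρ.real (Set.Ici m₀)) (hc : 0 < c) :
    ∃ B > 0, ∃ e > 0, ∃ k₀ : ℕ, Whp ρ fun n => {ω : Config d n |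
      Regular ω (meshCount d B n) (c * n / Real.log n) m₀ (e * Real.log n) k₀} := by
  have hd0 : d ≠ 0 := by omega
  set B := c * (2 * d) ^ d / m₀ with hB_def
  have hB : 0 < B := by positivity
  obtain ⟨e, he, k₀, hsparse⟩ := whp_sparse (ρ := ρ) hd0 hB hm₀_mass
  refine ⟨B, hB, e, he, k₀, ((whp_weight_nonneg hρ).inter hsparse).mono ?_⟩
  filter_upwards [eventually_ne_atTop 0, eventually_mul_mesh_pow_le hd0 hB,
    tendsto_log_natCast_atTop.eventually_ge_atTop (1 / e),
    tendsto_log_natCast_atTop.eventually_gt_atTop 0] with n hn hmesh hlog hlog_pos ω hω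
  refine ⟨hd, hω.1, by positivity, ?_, (div_le_iff₀' he).1 hlog, hω.2⟩
  calc c * n / Real.log n * (d * (2 * mesh (meshCount d B n))) ^ d
      = c * (2 * d) ^ d / Real.log n * (n * mesh (meshCount d B n) ^ d) := by
        rw [← mul_assoc, mul_pow, mul_comm (d : ℝ)]
        ring
    _ ≤ c * (2 * d) ^ d / Real.log n * (Real.log n / B) := by gcongr
    _ = m₀ := by
        rw [hB_def]
        field_simp

theorem whp_uncrowded (hd : d ≠ 0) (hρ : Integrable (fun w => w) ρ) (hc : 0 < c) (hB : 0 < B)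
    (k₀ : ℕ) : ∃ C, Whp ρ fun n => {ω : Config d n |
      Uncrowded ω (meshCount d B n) (c * n / Real.log n) (C * Real.log n) k₀} := by
  classical
  set r := localRadius d k₀ + 2
  set W := ∫ w, |w| ∂ρ
  set C := 4 ^ d * (2 * W / c + r ^ d / B)
  have hC : 0 ≤ C := by
    have : 0 ≤ W := integral_nonneg fun _ => abs_nonneg _
    positivity
  refine ⟨2 * C + 2, whp_of_eventually_measureReal_compl_le_div (C := 1) ?_⟩
  filter_upwards [eventually_ne_atTop 0, eventually_mul_mesh_pow_le hd hB,
    eventually_meshCount_pow_le hd hB, tendsto_log_natCast_atTop.eventually_ge_atTop 1]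
    with n hn hmesh hpow hlog
  set l := Real.log n
  set M := meshCount d B n
  have hθ : 0 < c * n / l := by positivity
  have hmean : n * (4 ^ d * (2 * W / (c * n / l) + (r * mesh M) ^ d)) ≤ C * l :=
    calc n * (4 ^ d * (2 * W / (c * n / l) + (r * mesh M) ^ d))
        = 4 ^ d * (2 * W / c * l + r ^ d * (n * mesh M ^ d)) := by
          rw [mul_pow]
          field_simp
      _ ≤ 4 ^ d * (2 * W / c * l + r ^ d * (l / B)) := by gcongr
      _ = C * l := by ring
  have hbad := law_exists_le_card_reaching_le (M := M) hd hρ n hθ r ((2 * C + 2) * l)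
  refine (measureReal_mono (fun ω hω => ?_) (measure_ne_top _ _)).trans
    (hbad.trans (mul_exp_le_one_div hn hpow (by linarith)))
  by_contra hcard
  simp only [Set.mem_ofPred_eq, not_exists, not_le] at hcard
  exact hω (.of_card_reaching_le hd hθ (by nlinarith) fun a => (hcard a).le)

end TypicalConfigurations

theorem one_le_poincareConst {k₀ M : ℕ} {N ℓ : ℝ} (hN : 0 ≤ N) :
    1 ≤ poincareConst d k₀ M N ℓ := by
  rw [poincareConst, add_assoc]
  exact le_add_of_nonneg_right (by positivity)

theorem poincareConst_mul_le {k₀ M : ℕ} {C e l : ℝ} (hC : 0 ≤ C) (hl : 1 ≤ l) (hM : l ^ 2 ≤ M) :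
    poincareConst d k₀ M (C * l) (e * l) ≤ poincareConst d k₀ 1 C e * M ^ 2 := by
  have hl3 : l ^ 3 ≤ (M : ℝ) ^ 2 :=
    calc l ^ 3 ≤ l ^ 4 := pow_le_pow_right₀ hl (by norm_num)
      _ = (l ^ 2) ^ 2 := by ring
      _ ≤ (M : ℝ) ^ 2 := by gcongr
  have hM1 : 1 ≤ (M : ℝ) ^ 2 := (one_le_pow₀ hl).trans hl3
  rw [poincareConst, poincareConst, mul_div_mul_right _ _ (by positivity), mul_pow, add_mul,
    add_mul, one_mul]
  refine add_le_add (add_le_add hM1 ?_) ?_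
  · calc 24 * (C ^ 3 * l ^ 3) * overlap d k₀ = 24 * C ^ 3 * overlap d k₀ * l ^ 3 := by ring
      _ ≤ 24 * C ^ 3 * overlap d k₀ * M ^ 2 := by gcongr
  · set Λ : ℝ := ((Grid.box d (localRadius d k₀ + 1)).card : ℝ)
    calc 6 * (C / e) ^ 2 * (overlap d k₀ * (d ^ 2 * (M : ℝ) ^ 2 * Λ ^ 3 + 1))
        ≤ 6 * (C / e) ^ 2 * (overlap d k₀ * (d ^ 2 * (M : ℝ) ^ 2 * Λ ^ 3 + (M : ℝ) ^ 2)) := by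
          gcongr
      _ = 6 * (C / e) ^ 2 * (overlap d k₀ * (d ^ 2 * ((1 : ℕ) : ℝ) ^ 2 * Λ ^ 3 + 1)) *
            (M : ℝ) ^ 2 := by
          push_cast
          ring

theorem Regular.mixingTime_le {n M : ℕ} [NeZero M] {ω : Config d n} {θ m₀ ℓ N : ℝ} {k₀ : ℕ}
    (h : Regular ω M θ m₀ ℓ k₀) (hU : Uncrowded ω M θ N k₀) (hG : (graph θ ω).Connected)
    (hn : 2 ≤ n) (hℓ : 4 ≤ ℓ) {T : ℕ} (hT : 4 * poincareConst d k₀ M N ℓ * Real.log n ≤ T) :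
    (graph θ ω).mixingTime (1 / (n : ℝ)) ≤ T := by
  have hmix := mixingTime_le_of_poincare hG (by rwa [Fintype.card_fin])
    (one_le_poincareConst (zero_le_one.trans hU.one_le)) (fun f hf => h.poincare hU hG hf)
    (h.signless_poincare hU hG hℓ) (by rwa [Fintype.card_fin])
  rwa [Fintype.card_fin] at hmix

theorem div_rpow_two_div_mul {x y B : ℝ} (hd : d ≠ 0) (hB : 0 ≤ B) (hx : 0 ≤ x) (hy : 0 < y) :
    (B * x / y) ^ ((2 : ℝ) / d) * y
      = B ^ ((2 : ℝ) / d) * (x ^ ((2 : ℝ) / d) * y ^ (((d : ℝ) - 2) / d)) := by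
  rw [Real.div_rpow (by positivity) hy.le, Real.mul_rpow hB hx, sub_div,
    div_self (Nat.cast_ne_zero.2 hd), Real.rpow_sub hy, Real.rpow_one]
  ring

theorem exists_eventually_mixingTime_le (hd : d ≠ 0) {B c e : ℝ} (hB : 0 < B) (he : 0 < e)
    (m₀ C : ℝ) (k₀ : ℕ) :
    ∃ K : ℝ, ∀ᶠ n : ℕ in atTop, ∀ ω : Config d n,
      Regular ω (meshCount d B n) (c * n / Real.log n) m₀ (e * Real.log n) k₀ →
      Uncrowded ω (meshCount d B n) (c * n / Real.log n) (C * Real.log n) k₀ →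
      (graph (c * n / Real.log n) ω).Connected →
      ((graph (c * n / Real.log n) ω).mixingTime (1 / (n : ℝ)) : ℝ≥0∞) ≤
        ENNReal.ofReal (K * ((n : ℝ) ^ ((2 : ℝ) / d) * Real.log n ^ (((d : ℝ) - 2) / d))) := by
  refine ⟨20 * poincareConst d k₀ 1 C e * B ^ ((2 : ℝ) / d), ?_⟩
  filter_upwards [eventually_ge_atTop 2, eventually_log_sq_le_meshCount hd hB,
    eventually_meshCount_sq_le (d := d) hB, tendsto_log_natCast_atTop.eventually_ge_atTop 1,
    tendsto_log_natCast_atTop.eventually_ge_atTop (4 / e)] with n hn hM hM_sq hlog hlog_e ω h hU hG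
  set l := Real.log n
  set A := poincareConst d k₀ (meshCount d B n) (C * l) (e * l)
  have hC : 0 ≤ C := (pos_of_mul_pos_left (one_pos.trans_le hU.one_le) (by positivity)).le
  have hA : 1 ≤ A := one_le_poincareConst (zero_le_one.trans hU.one_le)
  have hmix : (graph (c * n / l) ω).mixingTime (1 / (n : ℝ)) ≤ (⌈4 * A * l⌉₊ : ℕ) :=
    h.mixingTime_le hU hG hn ((div_le_iff₀' he).1 hlog_e) (Nat.le_ceil _)
  have hceil : (⌈4 * A * l⌉₊ : ℝ) ≤ 5 * (A * l) := by
    linarith [Nat.ceil_lt_add_one (show 0 ≤ 4 * A * l by positivity),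
      one_le_mul_of_one_le_of_one_le hA hlog]
  have hK : 0 ≤ poincareConst d k₀ 1 C e := zero_le_one.trans (one_le_poincareConst hC)
  calc ((graph (c * n / l) ω).mixingTime (1 / (n : ℝ)) : ℝ≥0∞)
      ≤ ((⌈4 * A * l⌉₊ : ℕ) : ℝ≥0∞) := by exact_mod_cast ENat.toENNReal_le.2 hmix
    _ = ENNReal.ofReal ⌈4 * A * l⌉₊ := (ENNReal.ofReal_natCast _).symm
    _ ≤ _ := ENNReal.ofReal_le_ofReal ?_
  calc (⌈4 * A * l⌉₊ : ℝ) ≤ 5 * (A * l) := hceil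
    _ ≤ 5 * (poincareConst d k₀ 1 C e * (4 * (B * n / l) ^ ((2 : ℝ) / d)) * l) := by
        gcongr
        exact (poincareConst_mul_le hC hlog hM).trans (by gcongr)
    _ = 20 * poincareConst d k₀ 1 C e * ((B * n / l) ^ ((2 : ℝ) / d) * l) := by ring
    _ = _ := by
        rw [div_rpow_two_div_mul hd hB.le (Nat.cast_nonneg n) (by positivity)]
        ring

end GTG

section WeightLaw

variable {ρ : Measure ℝ}

theorem integrable_id_of_tail [IsFiniteMeasure ρ] (hρ : ∀ᵐ w ∂ρ, 0 ≤ w) {p : ℝ} (hp : 1 < p)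
    (htail : (fun x : ℝ => ρ.real (Set.Ici x)) =O[atTop] fun x : ℝ => 1 / x ^ p) :
    Integrable (fun w => w) ρ := by
  obtain ⟨C, hC⟩ := htail.bound
  obtain ⟨y, hy⟩ := eventually_atTop.1 ((eventually_gt_atTop 0).and hC)
  have hy0 : 0 < y := (hy y le_rfl).1
  refine ⟨measurable_id.aestronglyMeasurable, ?_⟩
  rw [hasFiniteIntegral_iff_ofReal hρ, lintegral_eq_lintegral_meas_le ρ hρ aemeasurable_id,
    ← Set.Ioc_union_Ioi_eq_Ioi hy0.le]
  refine (lintegral_union_le _ _ _).trans_lt (ENNReal.add_lt_top.2 ⟨?_, ?_⟩)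
  · calc ∫⁻ t in Set.Ioc 0 y, ρ {w | t ≤ w} ≤ ∫⁻ _ in Set.Ioc 0 y, ρ Set.univ :=
          lintegral_mono fun _ => measure_mono (Set.subset_univ _)
      _ < ∞ := by
          rw [setLIntegral_const, Real.volume_Ioc]
          exact ENNReal.mul_lt_top (measure_lt_top _ _) ENNReal.ofReal_lt_top
  · have hint : IntegrableOn (fun t : ℝ => C * t ^ (-p)) (Set.Ioi y) :=
      (integrableOn_Ioi_rpow_of_lt (by linarith) hy0).const_mul C
    refine (setLIntegral_mono' measurableSet_Ioi fun t ht => ?_).trans_lt hint.lintegral_lt_top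
    obtain ⟨ht0, hle⟩ := hy t (le_of_lt ht)
    rw [Real.norm_of_nonneg measureReal_nonneg, Real.norm_of_nonneg (by positivity)] at hle
    change ρ (Set.Ici t) ≤ _
    rw [Real.rpow_neg ht0.le, ← one_div, ← ofReal_measureReal]
    exact ENNReal.ofReal_le_ofReal hle

theorem exists_pos_measureReal_Ici [IsFiniteMeasure ρ] (h : 0 < ρ (Set.Ioi 0)) :
    ∃ m > 0, 0 < ρ.real (Set.Ici m) := by
  have hcover : ⋃ k : ℕ, Set.Ici (1 / ((k : ℝ) + 1)) = Set.Ioi 0 :=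
    iUnion_Ici_eq_Ioi_of_lt_of_tendsto (fun _ => Nat.one_div_pos_of_nat)
      tendsto_one_div_add_atTop_nhds_zero_nat
  rw [← hcover] at h
  obtain ⟨k, hk⟩ := exists_measure_pos_of_not_measure_iUnion_null h.ne'
  exact ⟨1 / (k + 1), Nat.one_div_pos_of_nat, ENNReal.toReal_pos hk.ne' (measure_ne_top _ _)⟩

theorem measure_Ioi_zero_pos [NeZero ρ] (hac : ρ ≪ volume) (hρ : ∀ᵐ w ∂ρ, 0 ≤ w) :
    0 < ρ (Set.Ioi 0) := by
  rw [measure_congr ((hac.ae_eq Ioi_ae_eq_Ici).trans (eventuallyEq_univ.2 hρ))]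
  exact NeZero.pos _

end WeightLaw

theorem theorem2_general (d : ℕ) (hd : 2 ≤ d) (ρ : Measure ℝ) [IsProbabilityMeasure ρ]
    (hρ_nonneg : ∀ᵐ w ∂ρ, 0 ≤ w) (hρ_int : Integrable (fun w => w) ρ)
    (hρ_pos : 0 < ρ (Set.Ioi 0)) (c : ℝ) (hc : 0 < c) :
    ∃ K : ℝ, GTG.Whp (d := d) ρ (fun n =>
      {ω | (GTG.graph (c * (n : ℝ) / Real.log n) ω).Connected →
        ((GTG.graph (c * (n : ℝ) / Real.log n) ω).mixingTime (1 / (n : ℝ)) : ℝ≥0∞) ≤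
          ENNReal.ofReal
            (K * ((n : ℝ) ^ ((2 : ℝ) / d) * Real.log n ^ (((d : ℝ) - 2) / d)))}) := by
  have hd0 : d ≠ 0 := by omega
  obtain ⟨m₀, hm₀, hmass⟩ := exists_pos_measureReal_Ici hρ_pos
  obtain ⟨B, hB, e, he, k₀, hregular⟩ := GTG.whp_regular hd hρ_nonneg hm₀ hmass hc
  obtain ⟨C, huncrowded⟩ := GTG.whp_uncrowded hd0 hρ_int hc hB k₀
  obtain ⟨K, hK⟩ := GTG.exists_eventually_mixingTime_le (c := c) hd0 hB he m₀ C k₀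
  exact ⟨K, (hregular.inter huncrowded).mono (hK.mono fun n h ω hω => h ω hω.1 hω.2)⟩

theorem theorem2 (d : ℕ) (hd : 2 ≤ d)
    -- the weight law: an absolutely continuous probability distribution on `[0, ∞)`
    (ρ : Measure ℝ) [IsProbabilityMeasure ρ] (hρ : ρ ≪ volume) (hρ_nonneg : ∀ᵐ w ∂ρ, 0 ≤ w)
    (ν : ℝ) (hν : 0 < ν)
    (htail : (fun x : ℝ => ρ.real (Set.Ici x)) =O[atTop] (fun x : ℝ => 1 / x ^ ((d : ℝ) + ν)))
    (c : ℝ) (hc : 0 < c)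
    (hc_le : ENNReal.ofReal c ≤ ENNReal.ofReal (1 / ((d : ℝ) + 3)) *
      min (⨆ α ∈ Set.Ioc (0 : ℝ) (1 / 2), ENNReal.ofReal (α * GTG.quantile ρ α))
        (⨆ α ∈ Set.Ioo (1 / 2 : ℝ) 1, ENNReal.ofReal ((1 - α) * GTG.quantile ρ α))) :
    ∃ K : ℝ, GTG.Whp (d := d) ρ (fun n =>
      {ω | (GTG.graph (c * (n : ℝ) / Real.log n) ω).Connected →
        ((GTG.graph (c * (n : ℝ) / Real.log n) ω).mixingTime (1 / (n : ℝ)) : ℝ≥0∞) ≤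
          ENNReal.ofReal
            (K * ((n : ℝ) ^ ((2 : ℝ) / d) * Real.log n ^ (((d : ℝ) - 2) / d)))}) := by
  have hp : 1 < (d : ℝ) + ν := by
    have : (2 : ℝ) ≤ d := by exact_mod_cast hd
    linarith
  exact theorem2_general d hd ρ hρ_nonneg (integrable_id_of_tail hρ_nonneg hp htail)
    (measure_Ioi_zero_pos hρ hρ_nonneg) c hc
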